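/- Let $n\ge 1$ and consider an $n\times n$ input-queued switch in slotted time with queue lengths $q(t)=(q_{ij}(t))\in\mathbb{Z}_{\ge 0}^{n\times n}$ evolving by $$q_{ij}(t+1)=\max\{q_{ij}(t)+a_{ij}(t)-s_{ij}(t),\,0\},$$ where $s(t)$ is a permutation matrix chosen by the MaxWeight algorithm, i.e. a permutation matrix $s$ maximizing $\langle q(t),s\rangle=\sum_{ij}q_{ij}(t)s_{ij}$ (ties are broken by an arbitrary, possibly randomized, rule depending on $q(t)$ only, for instance uniformly at random). Let $\nu$ be a doubly stochastic $n\times n$ matrix with $\nu_{ij}>0$ for all $i,j$. For each $0<\epsilon<1$ consider such a switch in which the arrival vectors $a^{(\epsilon)}(t)\in\mathbb{Z}_{\ge0}^{n\times n}$ are i.i.d. over time $t$ and independent of the past queue lengths and of the scheduling decisions up to time $t$, the components $a^{(\epsilon)}_{ij}(t)$ are independent across pairs $(i,j)$ and bounded by a constant $a_{\max}$ not depending on $\epsilon$, and $$\mathbb{E}[a^{(\epsilon)}_{ij}(t)]=(1-\epsilon)\nu_{ij},\qquad \mathrm{Var}[a^{(\epsilon)}_{ij}(t)]=(\sigma^{(\epsilon)}_{ij})^2\longrightarrow\sigma_{ij}^2\quad\text{as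 }\epsilon\downarrow0 .$$ Write $\|\sigma\|^2=\sum_{ij}\sigma_{ij}^2$. Then for every $0<\epsilon<1$ the queue length Markov chain has exactly one stationary law, $q^{(\epsilon)}(t)$ converges in distribution to it from every initial state, and a random vector $\bar q^{(\epsilon)}$ with this law has integrable components. In the heavy traffic limit, $$\lim_{\epsilon\downarrow0}\epsilon\,\mathbb{E}\Big[\sum_{ij}\bar q^{(\epsilon)}_{ij}\Big]=\Big(1-\frac1{2n}\Big)\|\sigma\|^2,\qquad \lim_{\epsilon\downarrow0}\epsilon\,\mathbb{E}\Big[\sum_{ij}\nu_{ij}\bar q^{(\epsilon)}_{ij}\Big]=\frac{2n-1}{2n^2}\|\sigma\|^2,$$ and, for every permutation $\pi$ of $\{1,\dots,n\}$, $$\lim_{\epsilon\downarrow0}\epsilon\,\mathbb{E}\Big[\sum_{i}\bar q^{(\epsilon)}_{i\pi(i)}\Big]=\frac{2n-1}{2n^2}\|\sigma\|^2 .$$ -/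

import Mathlib

open Filter Topology MeasureTheory ProbabilityTheory

noncomputable section

/-- A nonnegative integer for every (input port, output port) pair: a vector of queue lengths,
or the vector of packets that arrive in one time slot. -/
abbrev SwitchState (n : ℕ) : Type := Fin n → Fin n → ℕ

/-- The service offered to the pair `(i, j)` by a maximal schedule. Maximal schedules are the
perfect matchings of inputs with outputs: the permutation `τ` connects input `i` to
output `τ i`. -/
def switchService {n : ℕ} (τ : Equiv.Perm (Fin n)) (i j : Fin n) : ℕ :=
  if τ i = j then 1 else 0

/-- The weight `⟨q, s⟩` of a schedule, given the queue lengths `q`. -/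
def scheduleWeight {n : ℕ} (q : SwitchState n) (τ : Equiv.Perm (Fin n)) : ℕ :=
  ∑ i, ∑ j, q i j * switchService τ i j

/-- A (randomized) scheduling rule is a MaxWeight rule if, whatever the queue lengths are, it only
picks schedules of maximal weight. The way ties are broken is arbitrary (for instance uniformly at
random). -/
def IsMaxWeight {n : ℕ} (S : SwitchState n → PMF (Equiv.Perm (Fin n))) : Prop :=
  ∀ q, ∀ τ ∈ (S q).support, ∀ τ', scheduleWeight q τ' ≤ scheduleWeight q τ

/-- `q(t+1) = [q(t) + a(t) - s(t)]⁺`, componentwise; subtraction of natural numbers is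
truncated at `0`. -/
def nextQueue {n : ℕ} (q a : SwitchState n) (τ : Equiv.Perm (Fin n)) : SwitchState n :=
  fun i j => q i j + a i j - switchService τ i j

/-- One step of the queue length Markov chain: given the queue lengths `q`, the schedule is drawn
from `S q` and, independently, the arrivals are drawn from `A`. -/
def switchStep {n : ℕ} (A : PMF (SwitchState n)) (S : SwitchState n → PMF (Equiv.Perm (Fin n)))
    (q : SwitchState n) : PMF (SwitchState n) :=
  (S q).bind fun τ => A.map fun a => nextQueue q a τ

/-- The law of the queue lengths at time `t` when the queue lengths at time `0` are `q₀`
(arrivals are i.i.d. over time). -/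
def queueLaw {n : ℕ} (A : PMF (SwitchState n)) (S : SwitchState n → PMF (Equiv.Perm (Fin n)))
    (q₀ : SwitchState n) : ℕ → PMF (SwitchState n)
  | 0 => PMF.pure q₀
  | t + 1 => (queueLaw A S q₀ t).bind (switchStep A S)

/-- `Q` is a stationary law of the queue length Markov chain. -/
def IsStationaryLaw {n : ℕ} (A : PMF (SwitchState n))
    (S : SwitchState n → PMF (Equiv.Perm (Fin n))) (Q : PMF (SwitchState n)) : Prop :=
  Q.bind (switchStep A S) = Q

/-- `A` is the law of the arrivals of one time slot: independent across the input-output pairs,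
at most `amax` at each pair, with mean arrival rates `rate`. -/
structure IsArrivalLaw {n : ℕ} (A : PMF (SwitchState n)) (amax : ℕ)
    (rate : Matrix (Fin n) (Fin n) ℝ) : Prop where
  indep : iIndepFun (fun (p : Fin n × Fin n) (a : SwitchState n) => a p.1 p.2) A.toMeasure
  bounded : ∀ a ∈ A.support, ∀ i j, a i j ≤ amax
  mean : ∀ i j, ∫ a, (a i j : ℝ) ∂A.toMeasure = rate i j

end

/-!
MaxWeight gives the norm of the queue lengths a negative drift away from `0`. Hence its exponential
is a geometric Foster–Lyapunov function, and Harris' theorem gives a unique stationary law,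
convergence to it, and all moments. The same drift estimate for the distance to the cone of
nonnegative matrices `w i + v j` does not degenerate as `ε → 0`: since `ν` has positive entries,
it can be perturbed in every direction that preserves the row and column sums, so MaxWeight gains
over `ν` an amount proportional to that distance. In stationarity the distance to the cone is
therefore bounded in mean square, uniformly in `ε` (state space collapse).

Let `P` be the orthogonal projection onto the span of the cone. All doubly stochastic matrices, in
particular `ν` and the schedules, have the same projection: the uniform matrix `J`, of norm `1`.
Stationarity of `‖P q‖²` then balances the drift `2 ε 𝔼⟪q, J⟫` against `ε²` plus the variance
`(2n - 1) / n² * ∑ Var a_ij` of `P a`, where `(2n - 1) / n²` is the squared norm of the projection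
of a coordinate vector. The only error comes from the unused service `u`. It is orthogonal to the
next queue lengths, so its cross term involves only their distance to the cone. As `𝔼‖u‖² = n ε`,
Young's inequality with weight `√ε` makes the error vanish. The bound on the distance also carries
the limit over from `J` to every doubly stochastic matrix.
-/

section PMFIntegral

variable {X Y : Type*} [MeasurableSpace X] [DiscreteMeasurableSpace X] [MeasurableSpace Y]

lemma ae_toMeasure_iff_forall_mem_support (p : PMF X) {φ : X → Prop} :
    (∀ᵐ x ∂p.toMeasure, φ x) ↔ ∀ x ∈ p.support, φ x := by
  rw [ae_iff, p.toMeasure_apply_eq_zero_iff (MeasurableSet.of_discrete), Set.disjoint_left]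
  simp

lemma integrable_toMeasure_of_finite_support {p : PMF X} (hp : p.support.Finite) (f : X → ℝ) :
    Integrable f p.toMeasure := by
  rw [← p.restrict_toMeasure_support]
  exact IntegrableOn.of_finite hp

lemma integral_toMeasure_mono {p : PMF X} {f g : X → ℝ} (hf : Integrable f p.toMeasure)
    (hg : Integrable g p.toMeasure) (h : ∀ x ∈ p.support, f x ≤ g x) :
    ∫ x, f x ∂p.toMeasure ≤ ∫ x, g x ∂p.toMeasure :=
  integral_mono_ae hf hg ((ae_toMeasure_iff_forall_mem_support p).2 h)

lemma integral_indicator_singleton_toMeasure (p : PMF X) (z : X) :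
    ∫ x, ({z} : Set X).indicator 1 x ∂p.toMeasure = (p z).toReal := by
  rw [integral_indicator_one MeasurableSet.of_discrete, measureReal_def,
    p.toMeasure_apply_singleton _ MeasurableSet.of_discrete]

lemma toMeasure_bind_eq_comp [Countable X] (p : PMF X) (k : X → PMF Y) :
    (p.bind k).toMeasure =
      ((Kernel.ofFunOfCountable fun x => (k x).toMeasure) ∘ₖ
        (Kernel.const Unit p.toMeasure)) () := by
  rw [← Measure.comp_eq_comp_const_apply]
  ext s hs
  rw [Measure.bind_apply hs (Kernel.aemeasurable _), lintegral_countable',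
    PMF.toMeasure_bind_apply _ _ _ hs]
  refine tsum_congr fun x => ?_
  rw [p.toMeasure_apply_singleton _ MeasurableSet.of_discrete, mul_comm]
  rfl

lemma integrable_integral_of_bind [Countable X] {p : PMF X} {k : X → PMF Y} {f : Y → ℝ}
    (hf : Integrable f (p.bind k).toMeasure) :
    Integrable (fun x => ∫ y, f y ∂(k x).toMeasure) p.toMeasure := by
  rw [toMeasure_bind_eq_comp] at hf
  have := hf.integral_comp
  rwa [Kernel.const_apply] at this

lemma integral_toMeasure_bind [Countable X] {p : PMF X} {k : X → PMF Y} {f : Y → ℝ}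
    (hf : Integrable f (p.bind k).toMeasure) :
    ∫ y, f y ∂(p.bind k).toMeasure = ∫ x, ∫ y, f y ∂(k x).toMeasure ∂p.toMeasure := by
  rw [toMeasure_bind_eq_comp] at hf ⊢
  rw [Kernel.integral_comp hf, Kernel.const_apply]
  rfl

lemma toReal_bind_apply [Countable X] [DiscreteMeasurableSpace Y] (p : PMF X) (k : X → PMF Y)
    (z : Y) : (p.bind k z).toReal = ∫ x, (k x z).toReal ∂p.toMeasure := by
  simp only [← integral_indicator_singleton_toMeasure]
  exact integral_toMeasure_bind ((integrable_const (1 : ℝ)).indicator MeasurableSet.of_discrete)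

end PMFIntegral

lemma finite_support_bind {X Y : Type*} {p : PMF X} {k : X → PMF Y} (hp : p.support.Finite)
    (hk : ∀ x, (k x).support.Finite) : (p.bind k).support.Finite := by
  rw [PMF.support_bind]
  exact hp.biUnion fun x _ => hk x

lemma eq_of_forall_apply_le {X : Type*} {p q : PMF X} (h : ∀ x, p x ≤ q x) : p = q := by
  ext x
  by_contra hx
  have := ENNReal.tsum_lt_tsum (by rw [p.tsum_coe]; exact ENNReal.one_ne_top) h
    (lt_of_le_of_ne (h x) hx)
  rw [p.tsum_coe, q.tsum_coe] at this
  exact lt_irrefl _ this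

section PointwiseLimit

variable {X : Type*} [Countable X] [MeasurableSpace X] [DiscreteMeasurableSpace X]

lemma tsum_mul_le_of_tendsto {p : ℕ → PMF X} {l : X → ENNReal}
    (hl : ∀ z, Tendsto (fun t => p t z) atTop (𝓝 (l z))) {f : X → ENNReal} (hf : ∀ z, f z ≠ ⊤)
    {M : ENNReal} (hM : ∀ t, ∫⁻ x, f x ∂(p t).toMeasure ≤ M) : ∑' z, f z * l z ≤ M := by
  rw [ENNReal.tsum_eq_iSup_sum]
  refine iSup_le fun F => le_of_tendsto'
    (tendsto_finsetSum F fun z _ => ENNReal.Tendsto.const_mul (hl z) (Or.inr (hf z)))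
    fun t => le_trans ?_ (hM t)
  simp only [lintegral_countable', PMF.toMeasure_apply_singleton _ _ MeasurableSet.of_discrete]
  exact ENNReal.sum_le_tsum F

lemma integrable_and_integral_le_of_tendsto {p : ℕ → PMF X} {q : PMF X}
    (h : ∀ z, Tendsto (fun t => p t z) atTop (𝓝 (q z))) {f : X → ℝ} (hf0 : ∀ x, 0 ≤ f x)
    (hf : ∀ t, Integrable f (p t).toMeasure) {M : ℝ} (hM : ∀ t, ∫ x, f x ∂(p t).toMeasure ≤ M) :
    Integrable f q.toMeasure ∧ ∫ x, f x ∂q.toMeasure ≤ M := by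
  have hM0 : 0 ≤ M := (integral_nonneg hf0).trans (hM 0)
  have hlintegral : ∫⁻ x, ENNReal.ofReal (f x) ∂q.toMeasure ≤ ENNReal.ofReal M := by
    rw [lintegral_countable']
    simp only [PMF.toMeasure_apply_singleton _ _ MeasurableSet.of_discrete]
    refine tsum_mul_le_of_tendsto h (fun _ => ENNReal.ofReal_ne_top) fun t => ?_
    rw [← ofReal_integral_eq_lintegral_ofReal (hf t) (.of_forall hf0)]
    exact ENNReal.ofReal_le_ofReal (hM t)
  have hint : Integrable f q.toMeasure :=
    (lintegral_ofReal_ne_top_iff_integrable Measurable.of_discrete.aestronglyMeasurable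
      (.of_forall hf0)).1 (ne_top_of_le_ne_top ENNReal.ofReal_ne_top hlintegral)
  refine ⟨hint, (ENNReal.ofReal_le_ofReal_iff hM0).1 ?_⟩
  rwa [ofReal_integral_eq_lintegral_ofReal hint (.of_forall hf0)]

lemma tsum_eq_one_of_tendsto {p : ℕ → PMF X} {l : X → ENNReal}
    (hl : ∀ z, Tendsto (fun t => p t z) atTop (𝓝 (l z))) {V : X → ℝ} (hV0 : ∀ x, 0 ≤ V x)
    (hVfin : ∀ L, {x | V x ≤ L}.Finite) (hV : ∀ t, Integrable V (p t).toMeasure) {M : ℝ}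
    (hM : ∀ t, ∫ x, V x ∂(p t).toMeasure ≤ M) : ∑' z, l z = 1 := by
  refine le_antisymm ?_ ?_
  · simpa using tsum_mul_le_of_tendsto (f := 1) (M := 1) hl (by simp) (by simp)
  · have hlevel (L : ℝ) (hL : 0 < L) : 1 ≤ ∑' z, l z + ENNReal.ofReal (M / L) := by
      have hF : Tendsto (fun t => ∑ z ∈ (hVfin L).toFinset, p t z) atTop
          (𝓝 (∑ z ∈ (hVfin L).toFinset, l z)) := tendsto_finsetSum _ fun z _ => hl z
      refine le_trans (ge_of_tendsto' (hF.add_const _) fun t => ?_)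
        (add_le_add_left (ENNReal.sum_le_tsum _) _)
      have hmarkov : (p t).toMeasure {x | L ≤ V x} ≤ ENNReal.ofReal (M / L) := by
        rw [← ofReal_measureReal]
        refine ENNReal.ofReal_le_ofReal ((le_div_iff₀' hL).2 ?_)
        exact (mul_meas_ge_le_integral_of_nonneg (.of_forall hV0) (hV t) L).trans (hM t)
      have hcover : (Set.univ : Set X) ⊆ ((hVfin L).toFinset : Set X) ∪ {x | L ≤ V x} :=
        fun x _ => by simpa using le_total (V x) L
      calc (1 : ENNReal) = (p t).toMeasure Set.univ := measure_univ.symm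
        _ ≤ _ := (measure_mono hcover).trans (measure_union_le _ _)
        _ ≤ _ := add_le_add (by rw [PMF.toMeasure_apply_finset]) hmarkov
    have hlim : Tendsto (fun L : ℝ => ∑' z, l z + ENNReal.ofReal (M / L)) atTop
        (𝓝 (∑' z, l z + ENNReal.ofReal 0)) :=
      tendsto_const_nhds.add
        (ENNReal.tendsto_ofReal (tendsto_const_nhds.div_atTop tendsto_id))
    simpa using ge_of_tendsto hlim ((eventually_gt_atTop 0).mono hlevel)

end PointwiseLimit

section MarkovChain

variable {X : Type*}

/-- The law at time `t` of the Markov chain with transition laws `P`, started at `x`. -/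
noncomputable def chainLaw (P : X → PMF X) (x : X) : ℕ → PMF X
  | 0 => PMF.pure x
  | t + 1 => (chainLaw P x t).bind P

variable {P : X → PMF X} {V : X → ℝ} {γ K : ℝ} {o : X}

lemma chainLaw_add (P : X → PMF X) (x : X) (s t : ℕ) :
    chainLaw P x (s + t) = (chainLaw P x s).bind fun y => chainLaw P y t := by
  induction t with
  | zero => simp [chainLaw, PMF.bind_pure]
  | succ t ih => rw [← add_assoc, chainLaw, ih, PMF.bind_bind]; rfl

lemma chainLaw_succ' (P : X → PMF X) (x : X) (t : ℕ) :
    chainLaw P x (t + 1) = (P x).bind fun y => chainLaw P y t := by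
  rw [add_comm, chainLaw_add]
  simp [chainLaw, PMF.pure_bind]

lemma bind_chainLaw_of_stationary {Q : PMF X} (hQ : Q.bind P = Q) (t : ℕ) :
    (Q.bind fun x => chainLaw P x t) = Q := by
  induction t with
  | zero => simp [chainLaw, PMF.bind_pure]
  | succ t ih =>
    simp only [chainLaw]
    rw [← PMF.bind_bind, ih, hQ]

lemma finite_support_chainLaw (hP : ∀ x, (P x).support.Finite) (x : X) (t : ℕ) :
    (chainLaw P x t).support.Finite := by
  induction t with
  | zero => simp [chainLaw, PMF.support_pure]
  | succ t ih => exact finite_support_bind ih hP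

lemma bind_eq_of_tendsto_chainLaw {Q : PMF X} {x : X}
    (hQ : ∀ z, Tendsto (fun t => chainLaw P x t z) atTop (𝓝 (Q z))) : Q.bind P = Q := by
  refine eq_of_forall_apply_le fun z => ?_
  rw [PMF.bind_apply, ENNReal.tsum_eq_iSup_sum]
  refine iSup_le fun F => le_of_tendsto_of_tendsto' (tendsto_finsetSum F fun y _ =>
    ENNReal.Tendsto.mul_const (hQ y) (Or.inr ((P y).apply_ne_top z)))
    ((tendsto_add_atTop_iff_nat 1).2 (hQ z)) fun t => ?_
  rw [chainLaw, PMF.bind_apply]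
  exact ENNReal.sum_le_tsum F

/-- The point `o` is reached, at every late enough time, with a probability that is bounded below
uniformly over each sublevel set of `V`. This is the minorization condition of Harris' theorem,
with the Dirac mass at `o` as the minorizing measure. -/
def IsUniformlyAccessible (P : X → PMF X) (V : X → ℝ) (o : X) : Prop :=
  ∀ L, ∃ N₀, ∀ N ≥ N₀, ∃ η > 0, ∀ x, V x ≤ L → η ≤ (chainLaw P x N o).toReal

variable [MeasurableSpace X]

/-- `V` is a Foster–Lyapunov function for the chain `P`, with a geometric drift towards its
sublevel sets. -/
structure HasGeometricDrift (P : X → PMF X) (V : X → ℝ) (γ K : ℝ) : Prop where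
  nonneg : ∀ x, 0 ≤ V x
  rate_nonneg : 0 ≤ γ
  rate_lt_one : γ < 1
  const_nonneg : 0 ≤ K
  integral_le : ∀ x, ∫ y, V y ∂(P x).toMeasure ≤ γ * V x + K

variable [DiscreteMeasurableSpace X]

lemma integrable_chainLaw (hP : ∀ x, (P x).support.Finite) (f : X → ℝ) (x : X) (t : ℕ) :
    Integrable f (chainLaw P x t).toMeasure :=
  integrable_toMeasure_of_finite_support (finite_support_chainLaw hP x t) f

lemma integral_sub_integral_le_of_forall_sub_le {μ ν : PMF X} (hμ : μ.support.Finite)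
    (hν : ν.support.Finite) {f : X → ℝ} {c β : ℝ} (hc : 0 ≤ c) (hβ : 0 ≤ β)
    (hV : ∀ x, 0 ≤ V x) (hf : ∀ x y, f x - f y ≤ c * (2 + β * (V x + V y))) (o : X) :
    ∫ x, f x ∂μ.toMeasure - ∫ x, f x ∂ν.toMeasure ≤
      c * (2 + β * (∫ x, V x ∂μ.toMeasure + ∫ x, V x ∂ν.toMeasure)
        - 2 * ((μ o).toReal * (ν o).toReal)) := by
  have hμi : ∀ g : X → ℝ, Integrable g μ.toMeasure := integrable_toMeasure_of_finite_support hμ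
  have hνi : ∀ g : X → ℝ, Integrable g ν.toMeasure := integrable_toMeasure_of_finite_support hν
  set I : X → ℝ := ({o} : Set X).indicator 1
  have hpoint : ∀ a b, f a - f b ≤ c * (2 + β * (V a + V b) - 2 * (I a * I b)) := by
    intro a b
    rcases eq_or_ne a b with rfl | hab
    · rw [sub_self]
      have hI : I a * I a ≤ 1 := by by_cases h : a = o <;> simp [I, h]
      have := mul_nonneg hβ (hV a)
      exact mul_nonneg hc (by linarith)
    · have hI : I a * I b = 0 := by
        by_cases h : a = o
        · simp [I, show b ≠ o from fun h' => hab (h.trans h'.symm)]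
        · simp [I, h]
      simpa [hI] using hf a b
  have hright : ∀ a, f a - ∫ x, f x ∂ν.toMeasure ≤
      c * (2 + β * (V a + ∫ x, V x ∂ν.toMeasure) - 2 * (I a * (ν o).toReal)) := by
    intro a
    have := integral_mono (hνi fun b => f a - f b) (hνi _) (hpoint a)
    rw [integral_sub (hνi _) (hνi _), integral_const_mul, integral_sub (hνi _) (hνi _),
      integral_add (hνi _) (hνi _), integral_const_mul, integral_add (hνi _) (hνi _),
      integral_const_mul, integral_const_mul, integral_indicator_singleton_toMeasure] at this
    simpa using this
  have := integral_mono (hμi fun a => f a - ∫ x, f x ∂ν.toMeasure) (hμi _) hright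
  rw [integral_sub (hμi _) (hμi _), integral_const_mul, integral_sub (hμi _) (hμi _),
    integral_add (hμi _) (hμi _), integral_const_mul, integral_add (hμi _) (hμi _),
    integral_const_mul, integral_mul_const, integral_indicator_singleton_toMeasure] at this
  simpa using this

/-- Hairer and Mattingly's choice of weights: below level `L` the overlap `p` pays for the constant
`K`, above it the drift does. -/
lemma exists_contraction_rate {L η : ℝ} (hγ0 : 0 ≤ γ) (hγ : γ < 1) (hK : 0 ≤ K) (hL : 0 < L)
    (hKL : 4 * K ≤ (1 - γ) * L) (hη : 0 < η) :
    ∃ α β : ℝ, 0 ≤ α ∧ α < 1 ∧ 0 < β ∧ ∀ s p : ℝ, 0 ≤ s → 0 ≤ p → (s ≤ L → η ≤ p) →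
      2 + β * (γ * s + 2 * K) - 2 * p ≤ α * (2 + β * s) := by
  obtain ⟨β, hβ, hβK⟩ : ∃ β : ℝ, 0 < β ∧ 2 * β * K ≤ η := by
    refine ⟨η / (2 * K + 1), by positivity, ?_⟩
    rw [mul_div_assoc', div_mul_eq_mul_div, div_le_iff₀ (by positivity)]
    linarith
  set γ' : ℝ := (1 + γ) / 2 with hγ'
  set far : ℝ := (2 + β * γ' * L) / (2 + β * L) with hfar
  have hden : 0 < 2 + β * L := by positivity
  have hγ'1 : γ' < 1 := by rw [hγ']; linarith
  have hfar1 : far < 1 := by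
    rw [hfar, div_lt_one hden]
    nlinarith [mul_pos hβ hL]
  set α := max far (max γ (1 - η / 2))
  have hfarα : far ≤ α := le_max_left _ _
  have hγα : γ ≤ α := (le_max_left _ _).trans (le_max_right _ _)
  have hηα : 1 - η / 2 ≤ α := (le_max_right _ _).trans (le_max_right _ _)
  refine ⟨α, β, hγ0.trans hγα, max_lt hfar1 (max_lt hγ (by linarith)), hβ, ?_⟩
  intro s p hs hp hsp
  have hβs : 0 ≤ β * s := by positivity
  rcases le_or_gt s L with hsL | hsL
  · have := hsp hsL
    have := mul_le_mul_of_nonneg_right hγα hβs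
    linarith
  · have hdrift : β * (γ * s + 2 * K) ≤ β * γ' * s := by
      have hs' : (1 - γ) * L ≤ (1 - γ) * s := mul_le_mul_of_nonneg_left hsL.le (by linarith)
      rw [mul_assoc]
      refine mul_le_mul_of_nonneg_left ?_ hβ.le
      rw [hγ']
      linarith
    have hratio : 2 + β * γ' * s ≤ far * (2 + β * s) := by
      rw [hfar, div_mul_eq_mul_div, le_div_iff₀ hden]
      nlinarith [mul_nonneg (mul_nonneg hβ.le (sub_nonneg.2 hγ'1.le)) (sub_nonneg.2 hsL.le)]
    have := mul_le_mul_of_nonneg_right hfarα (by positivity : 0 ≤ 2 + β * s)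
    linarith

variable [Countable X]

lemma integral_chainLaw_add (hP : ∀ x, (P x).support.Finite) (f : X → ℝ) (x : X) (s t : ℕ) :
    ∫ z, f z ∂(chainLaw P x (s + t)).toMeasure =
      ∫ y, ∫ z, f z ∂(chainLaw P y t).toMeasure ∂(chainLaw P x s).toMeasure := by
  rw [chainLaw_add, integral_toMeasure_bind]
  rw [← chainLaw_add]
  exact integrable_chainLaw hP f x _

lemma abs_chainLaw_sub_chainLaw_add_le (hP : ∀ x, (P x).support.Finite) {g : X → ℝ} {x z : X}
    {t : ℕ} (hg : ∀ y, |(chainLaw P x t z).toReal - (chainLaw P y t z).toReal| ≤ g y) (s : ℕ) :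
    |(chainLaw P x t z).toReal - (chainLaw P x (s + t) z).toReal| ≤
      ∫ y, g y ∂(chainLaw P x s).toMeasure := by
  have hint (f : X → ℝ) := integrable_chainLaw hP f x s
  calc |(chainLaw P x t z).toReal - (chainLaw P x (s + t) z).toReal|
      = |∫ y, ((chainLaw P x t z).toReal - (chainLaw P y t z).toReal)
          ∂(chainLaw P x s).toMeasure| := by
        rw [integral_sub (hint _) (hint _), chainLaw_add, toReal_bind_apply]
        simp
    _ ≤ ∫ y, g y ∂(chainLaw P x s).toMeasure :=
        abs_integral_le_integral_abs.trans (integral_mono (hint _) (hint _) hg)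

namespace HasGeometricDrift

lemma integral_chainLaw_le (h : HasGeometricDrift P V γ K) (hP : ∀ x, (P x).support.Finite)
    (x : X) (t : ℕ) :
    ∫ y, V y ∂(chainLaw P x t).toMeasure ≤ γ ^ t * V x + K / (1 - γ) := by
  have h1 : 0 < 1 - γ := sub_pos.2 h.rate_lt_one
  have hK := h.const_nonneg
  induction t with
  | zero =>
    have : 0 ≤ K / (1 - γ) := by positivity
    simpa [chainLaw, PMF.toMeasure_pure] using this
  | succ t ih =>
    have hint (f : X → ℝ) := integrable_chainLaw hP f x t
    calc ∫ y, V y ∂(chainLaw P x (t + 1)).toMeasure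
        = ∫ y, ∫ z, V z ∂(P y).toMeasure ∂(chainLaw P x t).toMeasure :=
          integral_toMeasure_bind (integrable_chainLaw hP V x (t + 1))
      _ ≤ ∫ y, (γ * V y + K) ∂(chainLaw P x t).toMeasure :=
          integral_mono (hint _) (hint _) h.integral_le
      _ = γ * ∫ y, V y ∂(chainLaw P x t).toMeasure + K := by
          rw [integral_add (hint _) (hint _), integral_const_mul]
          simp
      _ ≤ γ * (γ ^ t * V x + K / (1 - γ)) + K := by
          gcongr
          exact h.rate_nonneg
      _ = γ ^ (t + 1) * V x + K / (1 - γ) := by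
          field_simp
          ring

lemma integral_chainLaw_le_add (h : HasGeometricDrift P V γ K) (hP : ∀ x, (P x).support.Finite)
    (x : X) (t : ℕ) : ∫ y, V y ∂(chainLaw P x t).toMeasure ≤ V x + K / (1 - γ) :=
  (h.integral_chainLaw_le hP x t).trans (add_le_add_left
    (mul_le_of_le_one_left (h.nonneg x) (pow_le_one₀ h.rate_nonneg h.rate_lt_one.le)) _)

lemma exists_skeleton_contraction (h : HasGeometricDrift P V γ K)
    (hP : ∀ x, (P x).support.Finite) (ho : IsUniformlyAccessible P V o) :
    ∃ (N : ℕ) (α β : ℝ), 0 < N ∧ 0 ≤ α ∧ α < 1 ∧ 0 < β ∧ ∀ (f : X → ℝ) (c : ℝ), 0 ≤ c →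
      (∀ x y, f x - f y ≤ c * (2 + β * (V x + V y))) →
      ∀ x y, ∫ z, f z ∂(chainLaw P x N).toMeasure - ∫ z, f z ∂(chainLaw P y N).toMeasure ≤
        α * c * (2 + β * (V x + V y)) := by
  have h1γ : 0 < 1 - γ := sub_pos.2 h.rate_lt_one
  set K' := K / (1 - γ)
  have hK' : 0 ≤ K' := div_nonneg h.const_nonneg h1γ.le
  obtain ⟨N₀, hN₀⟩ := ho (8 * K' + 1)
  obtain ⟨N₁, hN₁⟩ := exists_pow_lt_of_lt_one (show (0 : ℝ) < 1 / 2 by norm_num) h.rate_lt_one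
  set N := N₀ + N₁ + 1
  obtain ⟨η, hη, hηo⟩ := hN₀ N (by omega)
  have hγN : γ ^ N ≤ 1 / 2 :=
    (pow_le_pow_of_le_one h.rate_nonneg h.rate_lt_one.le (by omega : N₁ ≤ N)).trans hN₁.le
  have hdrift (x : X) : ∫ y, V y ∂(chainLaw P x N).toMeasure ≤ 1 / 2 * V x + K' :=
    (h.integral_chainLaw_le hP x N).trans
      (add_le_add_left (mul_le_mul_of_nonneg_right hγN (h.nonneg x)) _)
  obtain ⟨α, β, hα0, hα1, hβ, hrate⟩ := exists_contraction_rate (γ := 1 / 2) (K := K')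
    (L := 8 * K' + 1) (η := η * η) (by norm_num) (by norm_num) hK' (by positivity)
    (by linarith) (by positivity)
  refine ⟨N, α, β, by omega, hα0, hα1, hβ, fun f c hc hf x y => ?_⟩
  have hVx := h.nonneg x
  have hVy := h.nonneg y
  have hoverlap (hL : V x + V y ≤ 8 * K' + 1) :
      η * η ≤ (chainLaw P x N o).toReal * (chainLaw P y N o).toReal :=
    mul_le_mul (hηo x (by linarith)) (hηo y (by linarith)) hη.le ENNReal.toReal_nonneg
  refine (integral_sub_integral_le_of_forall_sub_le (finite_support_chainLaw hP x N)
    (finite_support_chainLaw hP y N) hc hβ.le h.nonneg hf o).trans ?_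
  rw [mul_comm α c, mul_assoc]
  refine mul_le_mul_of_nonneg_left (le_trans ?_
    (hrate _ _ (add_nonneg hVx hVy) (by positivity) hoverlap)) hc
  have := mul_le_mul_of_nonneg_left (add_le_add (hdrift x) (hdrift y)) hβ.le
  linarith

lemma exists_abs_chainLaw_sub_le (h : HasGeometricDrift P V γ K)
    (hP : ∀ x, (P x).support.Finite) (ho : IsUniformlyAccessible P V o) :
    ∃ (β : ℝ) (r : ℕ → ℝ), 0 ≤ β ∧ (∀ t, 0 ≤ r t) ∧ Tendsto r atTop (𝓝 0) ∧ ∀ t x y z,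
      |(chainLaw P x t z).toReal - (chainLaw P y t z).toReal| ≤
        r t * (2 + β * (V x + V y)) := by
  obtain ⟨N, α, β, hN, hα0, hα1, hβ, hcontr⟩ := h.exists_skeleton_contraction hP ho
  have hskeleton (f : X → ℝ) (hf : ∀ x y, f x - f y ≤ 2 + β * (V x + V y)) (k : ℕ) : ∀ x y,
      ∫ z, f z ∂(chainLaw P x (N * k)).toMeasure - ∫ z, f z ∂(chainLaw P y (N * k)).toMeasure ≤
        α ^ k * (2 + β * (V x + V y)) := by
    induction k with
    | zero => simpa [chainLaw, PMF.toMeasure_pure, integral_dirac] using hf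
    | succ k ih =>
      intro x y
      rw [mul_add_one, add_comm, integral_chainLaw_add hP, integral_chainLaw_add hP, pow_succ']
      exact hcontr _ _ (by positivity) ih x y
  have hosc (t : ℕ) (z x y : X) : (chainLaw P x t z).toReal - (chainLaw P y t z).toReal ≤
      2 + β * (V x + V y) := by
    have hx : (chainLaw P x t z).toReal ≤ 1 :=
      ENNReal.toReal_le_of_le_ofReal zero_le_one (by simpa using PMF.coe_le_one _ z)
    have hy : 0 ≤ (chainLaw P y t z).toReal := ENNReal.toReal_nonneg
    have := mul_nonneg hβ.le (add_nonneg (h.nonneg x) (h.nonneg y))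
    linarith
  have hle (t : ℕ) (x y z : X) : (chainLaw P x t z).toReal - (chainLaw P y t z).toReal ≤
      α ^ (t / N) * (2 + β * (V x + V y)) := by
    have := hskeleton (fun w => (chainLaw P w (t % N) z).toReal) (hosc (t % N) z) (t / N) x y
    rwa [← toReal_bind_apply, ← toReal_bind_apply, ← chainLaw_add, ← chainLaw_add,
      Nat.div_add_mod] at this
  refine ⟨β, fun t => α ^ (t / N), hβ.le, fun t => pow_nonneg hα0 _,
    (tendsto_pow_atTop_nhds_zero_of_lt_one hα0 hα1).comp (Nat.tendsto_div_const_atTop hN.ne'),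
    fun t x y z => abs_sub_le_iff.2 ⟨hle t x y z, ?_⟩⟩
  rw [add_comm (V x)]
  exact hle t y x z

lemma exists_tendsto_chainLaw (h : HasGeometricDrift P V γ K) (hP : ∀ x, (P x).support.Finite)
    (ho : IsUniformlyAccessible P V o) :
    ∃ l : X → ENNReal, ∀ x z, Tendsto (fun t => chainLaw P x t z) atTop (𝓝 (l z)) := by
  obtain ⟨β, r, hβ, hr0, hr, hforget⟩ := h.exists_abs_chainLaw_sub_le hP ho
  set M := V o + K / (1 - γ)
  have hshift (z : X) (t s : ℕ) :
      |(chainLaw P o t z).toReal - (chainLaw P o (s + t) z).toReal| ≤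
        r t * (2 + β * (V o + M)) := by
    have hint (f : X → ℝ) := integrable_chainLaw hP f o s
    calc |(chainLaw P o t z).toReal - (chainLaw P o (s + t) z).toReal|
        ≤ ∫ y, r t * (2 + β * (V o + V y)) ∂(chainLaw P o s).toMeasure :=
          abs_chainLaw_sub_chainLaw_add_le hP (fun y => hforget t o y z) s
      _ = r t * (2 + β * (V o + ∫ y, V y ∂(chainLaw P o s).toMeasure)) := by
          rw [integral_const_mul, integral_add (hint _) (hint _), integral_const_mul,
            integral_add (hint _) (hint _)]
          simp
      _ ≤ r t * (2 + β * (V o + M)) := by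
          gcongr
          · exact hr0 t
          · exact h.integral_chainLaw_le_add hP o s
  have hlim (z : X) : ∃ l, Tendsto (fun t => (chainLaw P o t z).toReal) atTop (𝓝 l) := by
    refine cauchySeq_tendsto_of_complete
      (cauchySeq_of_le_tendsto_0' (fun t => r t * (2 + β * (V o + M))) (fun t u htu => ?_) ?_)
    · obtain ⟨s, rfl⟩ := Nat.exists_eq_add_of_le' htu
      exact hshift z t s
    · simpa using hr.mul_const (2 + β * (V o + M))
  choose l hl using hlim
  refine ⟨fun z => ENNReal.ofReal (l z), fun x z => ?_⟩
  have hdiff : Tendsto (fun t => (chainLaw P x t z).toReal - (chainLaw P o t z).toReal) atTop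
      (𝓝 0) := squeeze_zero_norm (fun t => hforget t x o z)
    (by simpa using hr.mul_const (2 + β * (V x + V o)))
  have hreal : Tendsto (fun t => (chainLaw P x t z).toReal) atTop (𝓝 (l z)) := by
    simpa using hdiff.add (hl z)
  simpa [ENNReal.ofReal_toReal (PMF.apply_ne_top _ z)] using ENNReal.tendsto_ofReal hreal

theorem exists_tendsto_pmf (h : HasGeometricDrift P V γ K) (hP : ∀ x, (P x).support.Finite)
    (ho : IsUniformlyAccessible P V o) (hVfin : ∀ L, {x | V x ≤ L}.Finite) :
    ∃ Q : PMF X, ∀ x z, Tendsto (fun t => chainLaw P x t z) atTop (𝓝 (Q z)) := by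
  obtain ⟨l, hl⟩ := h.exists_tendsto_chainLaw hP ho
  have hmass : ∑' z, l z = 1 := tsum_eq_one_of_tendsto (hl o) h.nonneg hVfin
    (integrable_chainLaw hP V o) (h.integral_chainLaw_le_add hP o)
  exact ⟨⟨l, hmass ▸ ENNReal.summable.hasSum⟩, hl⟩

lemma integrable_and_integral_le (h : HasGeometricDrift P V γ K)
    (hP : ∀ x, (P x).support.Finite) {Q : PMF X} {x : X}
    (hQ : ∀ z, Tendsto (fun t => chainLaw P x t z) atTop (𝓝 (Q z))) :
    Integrable V Q.toMeasure ∧ ∫ y, V y ∂Q.toMeasure ≤ V x + K / (1 - γ) :=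
  integrable_and_integral_le_of_tendsto hQ h.nonneg (integrable_chainLaw hP V x)
    (h.integral_chainLaw_le_add hP x)

end HasGeometricDrift

lemma eq_of_tendsto_chainLaw {Q Q' : PMF X}
    (hQ : ∀ x z, Tendsto (fun t => chainLaw P x t z) atTop (𝓝 (Q z)))
    (hQ' : Q'.bind P = Q') : Q' = Q := by
  ext z
  have hbound (p : PMF X) : (p z).toReal ≤ 1 :=
    ENNReal.toReal_le_of_le_ofReal zero_le_one (by simpa using PMF.coe_le_one p z)
  have hconv : Tendsto (fun t => ∫ x, (chainLaw P x t z).toReal ∂Q'.toMeasure) atTop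
      (𝓝 (∫ _, (Q z).toReal ∂Q'.toMeasure)) :=
    tendsto_integral_of_dominated_convergence (fun _ => 1) (fun t => .of_discrete)
      (integrable_const _)
      (fun t => ae_of_all _ fun x => by
        rw [Real.norm_of_nonneg ENNReal.toReal_nonneg]; exact hbound _)
      (ae_of_all _ fun x => (ENNReal.tendsto_toReal (Q.apply_ne_top z)).comp (hQ x z))
  have hconst (t : ℕ) : ∫ x, (chainLaw P x t z).toReal ∂Q'.toMeasure = (Q' z).toReal := by
    rw [← toReal_bind_apply Q' fun x => chainLaw P x t, bind_chainLaw_of_stationary hQ' t]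
  simp only [hconst] at hconv
  have := tendsto_nhds_unique tendsto_const_nhds hconv
  simp only [integral_const, probReal_univ, smul_eq_mul, one_mul] at this
  exact (ENNReal.toReal_eq_toReal_iff' (Q'.apply_ne_top z) (Q.apply_ne_top z)).1 this

end MarkovChain

section ExponentialDrift

variable {Ω : Type*} [MeasurableSpace Ω] {μ : Measure Ω} [IsProbabilityMeasure μ] {Y : Ω → ℝ}
  {v b c : ℝ}

lemma integral_le_sub_of_integral_sq_le (hY : Integrable Y μ)
    (hY2 : Integrable (fun ω => Y ω ^ 2) μ) (hc : 0 < c) (hv : 0 < v) (hbv : b ^ 2 / (2 * c) ≤ v)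
    (hdrift : ∫ ω, Y ω ^ 2 ∂μ ≤ v ^ 2 - 4 * c * v + b ^ 2) : ∫ ω, Y ω ∂μ ≤ v - c := by
  have htangent : ∫ ω, (v ^ 2 + 2 * v * (Y ω - v)) ∂μ ≤ ∫ ω, Y ω ^ 2 ∂μ :=
    integral_mono (by fun_prop) hY2 fun ω => by nlinarith [sq_nonneg (Y ω - v)]
  rw [integral_add (by fun_prop) (by fun_prop), integral_const_mul,
    integral_sub hY (by fun_prop)] at htangent
  simp only [integral_const, probReal_univ, one_smul] at htangent
  rw [div_le_iff₀ (by positivity)] at hbv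
  nlinarith

lemma integral_exp_mul_le_of_integral_le_sub (hY : AEMeasurable Y μ)
    (hb : ∀ᵐ ω ∂μ, Y ω ∈ Set.Icc (v - b) (v + b)) (hmean : ∫ ω, Y ω ∂μ ≤ v - c) {θ : ℝ}
    (hθ : 0 ≤ θ) (hθb : θ * b ≤ 1) :
    ∫ ω, Real.exp (θ * Y ω) ∂μ ≤ (1 - θ * c + (θ * b) ^ 2) * Real.exp (θ * v) := by
  have hYint : Integrable Y μ := .of_mem_Icc _ _ hY hb
  have htaylor : ∀ᵐ ω ∂μ, Real.exp (θ * Y ω) ≤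
      (1 + θ * (Y ω - v) + (θ * b) ^ 2) * Real.exp (θ * v) := by
    filter_upwards [hb] with ω hω
    have hsmall : |θ * (Y ω - v)| ≤ θ * b := by
      rw [abs_mul, abs_of_nonneg hθ]
      exact mul_le_mul_of_nonneg_left (abs_le.2 ⟨by linarith [hω.1], by linarith [hω.2]⟩) hθ
    have hexp := (abs_le.1 (Real.abs_exp_sub_one_sub_id_le (hsmall.trans hθb))).2
    have hsq : (θ * (Y ω - v)) ^ 2 ≤ (θ * b) ^ 2 := by
      rw [← sq_abs]
      gcongr
    rw [show θ * Y ω = θ * (Y ω - v) + θ * v by ring, Real.exp_add]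
    gcongr
    linarith
  refine (integral_mono_ae (integrable_exp_mul_of_mem_Icc hY hb) (by fun_prop)
    htaylor).trans ?_
  rw [integral_mul_const, integral_add (by fun_prop) (by fun_prop),
    integral_add (by fun_prop) (by fun_prop), integral_const_mul, integral_sub hYint (by fun_prop)]
  simp only [integral_const, probReal_univ, one_smul]
  gcongr
  nlinarith

lemma integral_exp_mul_le_of_integral_sq_le (hY : AEMeasurable Y μ)
    (hb : ∀ᵐ ω ∂μ, Y ω ∈ Set.Icc (v - b) (v + b)) (hc : 0 < c) (hcb : c ≤ b)
    (hdrift : ∫ ω, Y ω ^ 2 ∂μ ≤ v ^ 2 - 4 * c * v + b ^ 2) :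
    ∫ ω, Real.exp (c / (2 * b ^ 2) * Y ω) ∂μ ≤
      (1 - (c / (2 * b)) ^ 2) * Real.exp (c / (2 * b ^ 2) * v) + Real.exp 1 := by
  have hb0 : 0 < b := hc.trans_le hcb
  set θ := c / (2 * b ^ 2) with hθ
  have hθ0 : 0 < θ := by positivity
  have hθb : θ * b = c / (2 * b) := by rw [hθ]; field_simp
  have hθb2 : θ * b ≤ 1 / 2 := by
    rw [hθb, div_le_iff₀ (by positivity)]
    linarith
  have hrate : 0 ≤ 1 - (c / (2 * b)) ^ 2 := by
    rw [← hθb]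
    have : 0 < θ * b := by positivity
    nlinarith
  rcases le_or_gt (b ^ 2 / (2 * c)) v with hv | hv
  · have hY2 : Integrable (fun ω => Y ω ^ 2) μ :=
      (memLp_two_iff_integrable_sq hY.aestronglyMeasurable).1
        (memLp_of_bounded hb hY.aestronglyMeasurable 2)
    have hmean := integral_le_sub_of_integral_sq_le (.of_mem_Icc _ _ hY hb) hY2 hc
      (lt_of_lt_of_le (by positivity) hv) hv hdrift
    refine (integral_exp_mul_le_of_integral_le_sub hY hb hmean hθ0.le (by linarith)).trans ?_
    have hcoef : 1 - θ * c + (θ * b) ^ 2 = 1 - (c / (2 * b)) ^ 2 := by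
      rw [hθ]
      field_simp
      ring
    rw [hcoef]
    exact le_add_of_nonneg_right (Real.exp_pos 1).le
  · have hθv : θ * (b ^ 2 / (2 * c)) = 1 / 4 := by
      rw [hθ]
      field_simp
      norm_num
    have hle : ∀ᵐ ω ∂μ, Real.exp (θ * Y ω) ≤ Real.exp 1 := by
      filter_upwards [hb] with ω hω
      have := mul_le_mul_of_nonneg_left (show Y ω ≤ b ^ 2 / (2 * c) + b by
        linarith [hω.2]) hθ0.le
      exact Real.exp_le_exp.2 (by linarith)
    refine (integral_mono_ae (integrable_exp_mul_of_mem_Icc hY hb) (integrable_const _)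
      hle).trans ?_
    simp only [integral_const, probReal_univ, one_smul]
    exact le_add_of_nonneg_left (mul_nonneg hrate (Real.exp_pos _).le)

theorem hasGeometricDrift_exp {X : Type*} [MeasurableSpace X] [DiscreteMeasurableSpace X]
    {P : X → PMF X} {V : X → ℝ} (hc : 0 < c) (hcb : c ≤ b)
    (hjump : ∀ x, ∀ y ∈ (P x).support, |V y - V x| ≤ b)
    (hdrift : ∀ x, ∫ y, V y ^ 2 ∂(P x).toMeasure ≤ V x ^ 2 - 4 * c * V x + b ^ 2) :
    HasGeometricDrift P (fun x => Real.exp (c / (2 * b ^ 2) * V x)) (1 - (c / (2 * b)) ^ 2)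
      (Real.exp 1) where
  nonneg _ := (Real.exp_pos _).le
  rate_nonneg := by
    have hb : 0 < b := hc.trans_le hcb
    rw [sub_nonneg, sq_le_one_iff₀ (by positivity), div_le_one (by positivity)]
    linarith
  rate_lt_one := by
    have hb : 0 < b := hc.trans_le hcb
    have : 0 < (c / (2 * b)) ^ 2 := by positivity
    linarith
  const_nonneg := (Real.exp_pos 1).le
  integral_le x := integral_exp_mul_le_of_integral_sq_le Measurable.of_discrete.aemeasurable
    ((ae_toMeasure_iff_forall_mem_support _).2 fun y hy =>
      Set.mem_Icc_iff_abs_le.1 (by rw [abs_sub_comm]; exact hjump x y hy)) hc hcb (hdrift x)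

end ExponentialDrift

open scoped RealInnerProductSpace

section Hilbert

variable {F : Type*} [NormedAddCommGroup F] [InnerProductSpace ℝ F]

lemma exists_mem_infDist_eq_norm_sub [CompleteSpace F] (K : PointedCone ℝ F)
    (hK : IsClosed (K : Set F)) (x : F) :
    ∃ k ∈ K, Metric.infDist x K = ‖x - k‖ ∧ ⟪x - k, k⟫ = 0 ∧ ∀ y ∈ K, ⟪x - k, y⟫ ≤ 0 := by
  obtain ⟨k, hk, hmin⟩ := exists_norm_eq_iInf_of_complete_convex ⟨0, K.zero_mem⟩
    hK.isComplete K.convex x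
  have hobtuse := (norm_eq_iInf_iff_real_inner_le_zero K.convex hk).1 hmin
  have hdist : Metric.infDist x K = ‖x - k‖ := by
    rw [Metric.infDist_eq_iInf, hmin]
    simp only [dist_eq_norm]
  have horth : ⟪x - k, k⟫ = 0 := by
    have hdouble := hobtuse (k + k) (K.add_mem hk hk)
    have hzero := hobtuse 0 K.zero_mem
    rw [add_sub_cancel_right] at hdouble
    rw [zero_sub, inner_neg_right] at hzero
    linarith
  refine ⟨k, hk, hdist, horth, fun y hy => ?_⟩
  have := hobtuse y hy
  rwa [inner_sub_right, horth, sub_zero] at this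

variable (S : Submodule ℝ F) [S.HasOrthogonalProjection]

lemma norm_sub_starProjection_le_infDist {K : Set F} (hKS : K ⊆ S) (hK : K.Nonempty) (x : F) :
    ‖x - S.starProjection x‖ ≤ Metric.infDist x K := by
  refine (Metric.le_infDist hK).2 fun k hk => ?_
  rw [S.starProjection_minimal, dist_eq_norm]
  exact ciInf_le ⟨0, Set.forall_mem_range.2 fun _ => norm_nonneg _⟩ (⟨k, hKS hk⟩ : S)

lemma abs_inner_le_norm_mul_infDist_of_mem_orthogonal {K : Set F} (hKS : K ⊆ S)
    (hK : K.Nonempty) {y : F} (hy : y ∈ Sᗮ) (x : F) : |⟪y, x⟫| ≤ ‖y‖ * Metric.infDist x K := by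
  have hinner : ⟪y, x⟫ = ⟪y, x - S.starProjection x⟫ := by
    rw [inner_sub_right, S.inner_left_of_mem_orthogonal (S.starProjection_apply_mem x) hy,
      sub_zero]
  rw [hinner]
  exact (abs_real_inner_le_norm _ _).trans
    (mul_le_mul_of_nonneg_left (norm_sub_starProjection_le_infDist S hKS hK x) (norm_nonneg _))

lemma abs_norm_starProjection_sq_sub_le {x u : F} (hxu : ⟪x, u⟫ = 0) :
    |‖S.starProjection x‖ ^ 2 - ‖S.starProjection (x - u)‖ ^ 2| ≤
      2 * ‖x - S.starProjection x‖ * ‖u‖ + ‖u‖ ^ 2 := by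
  have hcross : ⟪S.starProjection x, S.starProjection u⟫ = -⟪x - S.starProjection x, u⟫ := by
    rw [inner_sub_left, hxu, zero_sub, neg_neg, ← S.inner_starProjection_left_eq_right,
      S.starProjection_eq_self_iff.2 (S.starProjection_apply_mem x)]
  have hinner := abs_le.1 (abs_real_inner_le_norm (x - S.starProjection x) u)
  have hu : ‖S.starProjection u‖ ^ 2 ≤ ‖u‖ ^ 2 := by
    gcongr
    exact S.norm_starProjection_apply_le u
  rw [map_sub, norm_sub_sq_real, hcross]
  refine abs_le.2 ⟨?_, ?_⟩ <;> nlinarith [sq_nonneg ‖S.starProjection u‖]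

end Hilbert

section CollapseCone

variable {ι κ : Type*}

/-- The matrix `M` as a point of the Euclidean space whose inner product is `∑ i j, M i j * N i j`,
the one for which the queue lengths of a switch are projected. -/
noncomputable def matVec : Matrix ι κ ℝ →ₗ[ℝ] EuclideanSpace ℝ (ι × κ) where
  toFun M := WithLp.toLp 2 fun p => M p.1 p.2
  map_add' _ _ := rfl
  map_smul' _ _ := rfl

@[simp] lemma matVec_apply (M : Matrix ι κ ℝ) (p : ι × κ) : matVec M p = M p.1 p.2 := rfl

variable [Fintype ι] [Fintype κ]

lemma inner_matVec_right (x : EuclideanSpace ℝ (ι × κ)) (M : Matrix ι κ ℝ) :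
    ⟪x, matVec M⟫ = ∑ i, ∑ j, M i j * x (i, j) := by
  simp [PiLp.inner_apply, Fintype.sum_prod_type]

/-- The matrices of the form `w i + v j`, the orthogonal complement of the matrices all of whose
row and column sums vanish. -/
def marginSpace (ι κ : Type*) [Fintype ι] [Fintype κ] :
    Submodule ℝ (EuclideanSpace ℝ (ι × κ)) where
  carrier := {x | ∃ (w : ι → ℝ) (v : κ → ℝ), ∀ i j, x (i, j) = w i + v j}
  add_mem' := by
    rintro x y ⟨w, v, hx⟩ ⟨w', v', hy⟩
    exact ⟨w + w', v + v', fun i j => by simp [hx, hy]; ring⟩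
  zero_mem' := ⟨0, 0, fun i j => by simp⟩
  smul_mem' := by
    rintro c x ⟨w, v, hx⟩
    exact ⟨c • w, c • v, fun i j => by simp [hx, mul_add]⟩

lemma mem_marginSpace_orthogonal {y : EuclideanSpace ℝ (ι × κ)} (hrow : ∀ i, ∑ j, y (i, j) = 0)
    (hcol : ∀ j, ∑ i, y (i, j) = 0) : y ∈ (marginSpace ι κ)ᗮ := by
  rintro x ⟨w, v, hx⟩
  calc ⟪x, y⟫ = ∑ i, ∑ j, (w i * y (i, j) + v j * y (i, j)) := by
        simp [PiLp.inner_apply, Fintype.sum_prod_type, hx, mul_comm, add_mul]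
    _ = ∑ i, w i * ∑ j, y (i, j) + ∑ j, v j * ∑ i, y (i, j) := by
        simp only [Finset.sum_add_distrib, Finset.mul_sum]
        rw [Finset.sum_comm (γ := κ)]
    _ = 0 := by simp [hrow, hcol]

lemma starProjection_marginSpace_eq {x y : EuclideanSpace ℝ (ι × κ)}
    (hrow : ∀ i, ∑ j, x (i, j) = ∑ j, y (i, j)) (hcol : ∀ j, ∑ i, x (i, j) = ∑ i, y (i, j)) :
    (marginSpace ι κ).starProjection x = (marginSpace ι κ).starProjection y := by
  rw [← sub_eq_zero, ← map_sub]
  exact (marginSpace ι κ).starProjection_apply_eq_zero_iff.2 <|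
    mem_marginSpace_orthogonal (fun i => by simp [hrow]) fun j => by simp [hcol]

lemma norm_starProjection_marginSpace_single_sq [DecidableEq ι] [DecidableEq κ] [Nonempty ι]
    [Nonempty κ] (p : ι × κ) :
    ‖(marginSpace ι κ).starProjection (EuclideanSpace.single p 1)‖ ^ 2 =
      1 / (Fintype.card ι : ℝ) + 1 / Fintype.card κ - 1 / (Fintype.card ι * Fintype.card κ) := by
  obtain ⟨a, b⟩ := p
  set m := (Fintype.card ι : ℝ) with hm
  set n := (Fintype.card κ : ℝ) with hn
  have hm0 : m ≠ 0 := by simp [hm]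
  have hn0 : n ≠ 0 := by simp [hn]
  set z : EuclideanSpace ℝ (ι × κ) := matVec <| Matrix.of fun i j =>
    (if i = a then 1 / n else 0) + ((if j = b then 1 / m else 0) - 1 / (m * n)) with hz
  have hzmem : z ∈ marginSpace ι κ := ⟨fun i => if i = a then 1 / n else 0,
    fun j => (if j = b then 1 / m else 0) - 1 / (m * n), fun i j => rfl⟩
  have hproj : (marginSpace ι κ).starProjection (EuclideanSpace.single (a, b) 1) = z := by
    rw [← (marginSpace ι κ).starProjection_eq_self_iff.2 hzmem]
    refine starProjection_marginSpace_eq (fun i => ?_) fun j => ?_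
    · by_cases hi : i = a <;>
        simp [hz, Finset.sum_add_distrib, Finset.sum_sub_distrib, hi, ← hn] <;> field_simp <;>
        norm_num
    · by_cases hj : j = b <;>
        simp [hz, Finset.sum_add_distrib, Finset.sum_sub_distrib, hj, ← hm] <;> field_simp <;>
        norm_num
  rw [← real_inner_self_eq_norm_sq, (marginSpace ι κ).inner_starProjection_left_eq_right,
    (marginSpace ι κ).starProjection_eq_self_iff.2
      ((marginSpace ι κ).starProjection_apply_mem _), hproj, EuclideanSpace.inner_single_left]
  simp [hz]
  ring

/-- The doubly stochastic matrix with equal entries, the orthogonal projection of every doubly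
stochastic matrix onto `marginSpace`. -/
noncomputable def uniformMatrix (ι : Type*) [Fintype ι] : Matrix ι ι ℝ :=
  Matrix.of fun _ _ => (Fintype.card ι : ℝ)⁻¹

lemma uniformMatrix_mem_doublyStochastic [DecidableEq ι] [Nonempty ι] :
    uniformMatrix ι ∈ doublyStochastic ℝ ι := by
  rw [mem_doublyStochastic_iff_sum]
  simp [uniformMatrix]

lemma inner_matVec_uniformMatrix (x : EuclideanSpace ℝ (ι × ι)) :
    ⟪x, matVec (uniformMatrix ι)⟫ = (Fintype.card ι : ℝ)⁻¹ * ∑ p, x p := by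
  simp [inner_matVec_right, uniformMatrix, Finset.mul_sum, Fintype.sum_prod_type]

lemma norm_matVec_uniformMatrix [Nonempty ι] : ‖matVec (uniformMatrix ι)‖ = 1 := by
  rw [← sq_eq_sq₀ (norm_nonneg _) zero_le_one, ← real_inner_self_eq_norm_sq,
    inner_matVec_uniformMatrix]
  simp [uniformMatrix]

lemma starProjection_marginSpace_matVec_eq [DecidableEq ι] {M N : Matrix ι ι ℝ}
    (hM : M ∈ doublyStochastic ℝ ι) (hN : N ∈ doublyStochastic ℝ ι) :
    (marginSpace ι ι).starProjection (matVec M) = (marginSpace ι ι).starProjection (matVec N) := by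
  rw [mem_doublyStochastic_iff_sum] at hM hN
  exact starProjection_marginSpace_eq (by simp [hM.2.1, hN.2.1]) (by simp [hM.2.2, hN.2.2])

lemma matVec_sub_mem_marginSpace_orthogonal [DecidableEq ι] {M N : Matrix ι ι ℝ}
    (hM : M ∈ doublyStochastic ℝ ι) (hN : N ∈ doublyStochastic ℝ ι) :
    matVec M - matVec N ∈ (marginSpace ι ι)ᗮ := by
  rw [← (marginSpace ι ι).starProjection_apply_eq_zero_iff, map_sub,
    starProjection_marginSpace_matVec_eq hM hN, sub_self]

lemma starProjection_marginSpace_matVec [DecidableEq ι] [Nonempty ι] {M : Matrix ι ι ℝ}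
    (hM : M ∈ doublyStochastic ℝ ι) :
    (marginSpace ι ι).starProjection (matVec M) = matVec (uniformMatrix ι) := by
  rw [starProjection_marginSpace_matVec_eq hM uniformMatrix_mem_doublyStochastic,
    Submodule.starProjection_eq_self_iff]
  exact ⟨0, fun _ => (Fintype.card ι : ℝ)⁻¹, fun i j => by simp [uniformMatrix]⟩

lemma inner_matVec_uniformMatrix_of_mem_doublyStochastic [DecidableEq ι] [Nonempty ι]
    {M : Matrix ι ι ℝ} (hM : M ∈ doublyStochastic ℝ ι) :
    ⟪matVec M, matVec (uniformMatrix ι)⟫ = 1 := by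
  have hrow := (mem_doublyStochastic_iff_sum.1 hM).2.1
  simp [inner_matVec_uniformMatrix, Fintype.sum_prod_type, hrow]

/-- The cone onto which MaxWeight collapses the queue lengths in heavy traffic: the matrices
`w i + v j` with nonnegative entries. -/
def collapseCone (ι κ : Type*) [Fintype ι] [Fintype κ] :
    PointedCone ℝ (EuclideanSpace ℝ (ι × κ)) where
  carrier := {x | x ∈ marginSpace ι κ ∧ ∀ p, 0 ≤ x p}
  add_mem' hx hy := ⟨add_mem hx.1 hy.1, fun p => add_nonneg (hx.2 p) (hy.2 p)⟩
  zero_mem' := ⟨zero_mem _, fun _ => le_rfl⟩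
  smul_mem' c _ hx := ⟨Submodule.smul_mem _ (c : ℝ) hx.1, fun p => mul_nonneg c.2 (hx.2 p)⟩

lemma isClosed_collapseCone : IsClosed (collapseCone ι κ : Set (EuclideanSpace ℝ (ι × κ))) := by
  have hnonneg : IsClosed {x : EuclideanSpace ℝ (ι × κ) | ∀ p, 0 ≤ x p} := by
    simp only [Set.ofPred_forall]
    exact isClosed_iInter fun p => isClosed_le continuous_const (by fun_prop)
  exact (marginSpace ι κ).closed_of_finiteDimensional.inter hnonneg

lemma collapseCone_subset_marginSpace :
    (collapseCone ι κ : Set (EuclideanSpace ℝ (ι × κ))) ⊆ marginSpace ι κ := fun _ hx => hx.1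

lemma matVec_single_row_mem_collapseCone [DecidableEq ι] (i : ι) :
    matVec (Matrix.of fun a _ => if a = i then 1 else 0) ∈ collapseCone ι κ :=
  ⟨⟨fun a => if a = i then 1 else 0, 0, fun a b => by simp⟩, fun p => by
    simp only [matVec_apply, Matrix.of_apply]; split_ifs <;> simp⟩

lemma matVec_single_col_mem_collapseCone [DecidableEq κ] (j : κ) :
    matVec (Matrix.of fun _ b => if b = j then 1 else 0) ∈ collapseCone ι κ :=
  ⟨⟨0, fun b => if b = j then 1 else 0, fun a b => by simp⟩, fun p => by
    simp only [matVec_apply, Matrix.of_apply]; split_ifs <;> simp⟩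

lemma exists_ge_rowSum_colSum_eq_zero {M : Matrix ι κ ℝ} (hrow : ∀ i, ∑ j, M i j ≤ 0)
    (hcol : ∀ j, ∑ i, M i j ≤ 0) :
    ∃ N : Matrix ι κ ℝ, (∀ i j, M i j ≤ N i j) ∧ (∀ i, ∑ j, N i j = 0) ∧ ∀ j, ∑ i, N i j = 0 := by
  set T := ∑ i, ∑ j, M i j with hT
  have hT' : ∑ j, ∑ i, M i j = T := Finset.sum_comm
  have hT0 : T ≤ 0 := Finset.sum_nonpos fun i _ => hrow i
  refine ⟨Matrix.of fun i j => M i j + (∑ l, M i l) * (∑ l, M l j) / (-T), fun i j => ?_,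
    fun i => ?_, fun j => ?_⟩
  · have := div_nonneg (mul_nonneg_of_nonpos_of_nonpos (hrow i) (hcol j)) (neg_nonneg.2 hT0)
    simpa only [Matrix.of_apply, le_add_iff_nonneg_right]
  · simp only [Matrix.of_apply]
    rw [Finset.sum_add_distrib, ← Finset.sum_div, ← Finset.mul_sum, hT']
    by_cases h : T = 0
    · rw [h, neg_zero, div_zero, add_zero]
      exact (Finset.sum_eq_zero_iff_of_nonpos fun i _ => hrow i).1 (hT.symm.trans h) i
        (Finset.mem_univ i)
    · field_simp
      ring
  · simp only [Matrix.of_apply]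
    rw [Finset.sum_add_distrib, ← Finset.sum_div, ← Finset.sum_mul, ← hT]
    by_cases h : T = 0
    · rw [h, neg_zero, div_zero, add_zero]
      exact (Finset.sum_eq_zero_iff_of_nonpos fun i _ => hcol i).1 (hT'.trans h) j
        (Finset.mem_univ j)
    · field_simp
      ring

lemma exists_rowSum_colSum_eq_zero_infDist_sq_le {x : EuclideanSpace ℝ (ι × κ)}
    (hx : ∀ p, 0 ≤ x p) :
    ∃ N : Matrix ι κ ℝ, (∀ i j, -Metric.infDist x (collapseCone ι κ) ≤ N i j) ∧
      (∀ i, ∑ j, N i j = 0) ∧ (∀ j, ∑ i, N i j = 0) ∧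
      Metric.infDist x (collapseCone ι κ) ^ 2 ≤ ⟪x, matVec N⟫ := by
  classical
  obtain ⟨k, -, hdist, horth, hpolar⟩ :=
    exists_mem_infDist_eq_norm_sub _ (isClosed_collapseCone (ι := ι) (κ := κ)) x
  set w := x - k
  have hrow (i : ι) : ∑ j, w (i, j) ≤ 0 := by
    simpa [inner_matVec_right] using hpolar _ (matVec_single_row_mem_collapseCone i)
  have hcol (j : κ) : ∑ i, w (i, j) ≤ 0 := by
    simpa [inner_matVec_right] using hpolar _ (matVec_single_col_mem_collapseCone j)
  obtain ⟨N, hwN, hNrow, hNcol⟩ :=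
    exists_ge_rowSum_colSum_eq_zero (M := Matrix.of fun i j => w (i, j)) hrow hcol
  refine ⟨N, fun i j => ?_, hNrow, hNcol, ?_⟩
  · rw [hdist]
    exact (neg_le_of_abs_le (PiLp.norm_apply_le w (i, j))).trans (hwN i j)
  · calc Metric.infDist x (collapseCone ι κ) ^ 2 = ⟪x, w⟫ := by
          rw [hdist, ← real_inner_self_eq_norm_sq, ← sub_eq_zero, ← inner_sub_left,
            sub_sub_cancel_left, inner_neg_left, real_inner_comm, horth, neg_zero]
      _ = ∑ i, ∑ j, w (i, j) * x (i, j) :=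
          inner_matVec_right x (Matrix.of fun i j => w (i, j))
      _ ≤ ⟪x, matVec N⟫ := by
          rw [inner_matVec_right]
          gcongr with i _ j
          · exact hx _
          · exact hwN i j

lemma exists_doublyStochastic_inner_add_mul_infDist_le [DecidableEq ι] {ν : Matrix ι ι ℝ}
    (hν : ν ∈ doublyStochastic ℝ ι) {δ : ℝ} (hδ : 0 ≤ δ) (hνδ : ∀ i j, δ ≤ ν i j)
    {x : EuclideanSpace ℝ (ι × ι)} (hx : ∀ p, 0 ≤ x p) :
    ∃ M ∈ doublyStochastic ℝ ι,
      ⟪x, matVec ν⟫ + δ * Metric.infDist x (collapseCone ι ι) ≤ ⟪x, matVec M⟫ := by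
  set D := Metric.infDist x (collapseCone ι ι)
  obtain ⟨N, hDN, hrow, hcol, hinner⟩ := exists_rowSum_colSum_eq_zero_infDist_sq_le hx
  rcases Metric.infDist_nonneg.eq_or_lt' (a := D) with hD | hD
  · exact ⟨ν, hν, by rw [hD, mul_zero, add_zero]⟩
  rw [mem_doublyStochastic_iff_sum] at hν
  refine ⟨ν + (δ / D) • N, mem_doublyStochastic_iff_sum.2 ⟨fun i j => ?_, fun i => ?_,
    fun j => ?_⟩, ?_⟩
  · have : δ / D * -D ≤ δ / D * N i j := by gcongr; exact hDN i j
    rw [mul_neg, div_mul_cancel₀ _ hD.ne'] at this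
    simpa using (by linarith [hνδ i j] : 0 ≤ ν i j + δ / D * N i j)
  · simp [Finset.sum_add_distrib, ← Finset.mul_sum, hrow, hν.2.1]
  · simp [Finset.sum_add_distrib, ← Finset.mul_sum, hcol, hν.2.2]
  · rw [map_add, map_smul, inner_add_right, inner_smul_right]
    calc ⟪x, matVec ν⟫ + δ * D = ⟪x, matVec ν⟫ + δ / D * D ^ 2 := by field_simp
      _ ≤ _ := by gcongr

end CollapseCone

section SwitchVectors

variable {n : ℕ} {S : SwitchState n → PMF (Equiv.Perm (Fin n))} {q a : SwitchState n}
  {τ : Equiv.Perm (Fin n)}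

/-- The queue lengths (or the arrivals) as a point of Euclidean space. -/
noncomputable def queueVec (q : SwitchState n) : EuclideanSpace ℝ (Fin n × Fin n) :=
  matVec (Matrix.of fun i j => (q i j : ℝ))

/-- The service offered by the schedule `τ` as a point of Euclidean space. -/
noncomputable def serviceVec (τ : Equiv.Perm (Fin n)) : EuclideanSpace ℝ (Fin n × Fin n) :=
  matVec (τ.permMatrix ℝ)

/-- The service that the schedule `τ` offers to queues without any packet to serve. -/
noncomputable def unusedVec (q a : SwitchState n) (τ : Equiv.Perm (Fin n)) :
    EuclideanSpace ℝ (Fin n × Fin n) :=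
  queueVec (nextQueue q a τ) - (queueVec q + queueVec a - serviceVec τ)

lemma queueVec_apply (q : SwitchState n) (p : Fin n × Fin n) : queueVec q p = q p.1 p.2 := rfl

lemma queueVec_nonneg (q : SwitchState n) (p : Fin n × Fin n) : 0 ≤ queueVec q p :=
  Nat.cast_nonneg _

@[simp] lemma queueVec_zero : queueVec (0 : SwitchState n) = 0 := by
  ext p
  simp [queueVec_apply]

lemma serviceVec_apply (τ : Equiv.Perm (Fin n)) (p : Fin n × Fin n) :
    serviceVec τ p = switchService τ p.1 p.2 := by
  simp [serviceVec, Equiv.Perm.permMatrix, PEquiv.toMatrix_apply, switchService, eq_comm]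

lemma queueVec_nextQueue (q a : SwitchState n) (τ : Equiv.Perm (Fin n)) :
    queueVec (nextQueue q a τ) = queueVec q + queueVec a - serviceVec τ + unusedVec q a τ := by
  rw [unusedVec, add_sub_cancel]

lemma inner_queueVec_serviceVec (q : SwitchState n) (τ : Equiv.Perm (Fin n)) :
    ⟪queueVec q, serviceVec τ⟫ = scheduleWeight q τ := by
  simp [PiLp.inner_apply, Fintype.sum_prod_type, queueVec_apply, serviceVec_apply,
    scheduleWeight, mul_comm]

lemma inner_matVec_le_of_isMaxWeight (hS : IsMaxWeight S) (hτ : τ ∈ (S q).support)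
    {M : Matrix (Fin n) (Fin n) ℝ} (hM : M ∈ doublyStochastic ℝ (Fin n)) :
    ⟪queueVec q, matVec M⟫ ≤ ⟪queueVec q, serviceVec τ⟫ := by
  have hconvex : Convex ℝ {M | ⟪queueVec q, matVec M⟫ ≤ ⟪queueVec q, serviceVec τ⟫} :=
    convex_halfSpace_le ((innerₛₗ ℝ (queueVec q)).comp matVec).isLinear _
  rw [← SetLike.mem_coe, doublyStochastic_eq_convexHull_permMatrix] at hM
  refine convexHull_min ?_ hconvex hM
  rintro _ ⟨π, rfl⟩
  change ⟪queueVec q, serviceVec π⟫ ≤ ⟪queueVec q, serviceVec τ⟫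
  rw [inner_queueVec_serviceVec, inner_queueVec_serviceVec]
  exact_mod_cast hS q τ hτ π

lemma inner_matVec_add_mul_infDist_le_of_isMaxWeight (hS : IsMaxWeight S)
    (hτ : τ ∈ (S q).support) {ν : Matrix (Fin n) (Fin n) ℝ} (hν : ν ∈ doublyStochastic ℝ (Fin n))
    {δ : ℝ} (hδ : 0 ≤ δ) (hνδ : ∀ i j, δ ≤ ν i j) :
    ⟪queueVec q, matVec ν⟫ + δ * Metric.infDist (queueVec q) (collapseCone (Fin n) (Fin n)) ≤
      ⟪queueVec q, serviceVec τ⟫ := by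
  obtain ⟨M, hM, hle⟩ :=
    exists_doublyStochastic_inner_add_mul_infDist_le hν hδ hνδ (queueVec_nonneg q)
  exact hle.trans (inner_matVec_le_of_isMaxWeight hS hτ hM)

lemma switchService_le_one (τ : Equiv.Perm (Fin n)) (i j : Fin n) : switchService τ i j ≤ 1 := by
  unfold switchService
  split_ifs <;> simp

lemma unusedVec_apply_eq_zero_or (q a : SwitchState n) (τ : Equiv.Perm (Fin n))
    (p : Fin n × Fin n) :
    unusedVec q a τ p = 0 ∨
      unusedVec q a τ p = 1 ∧ q p.1 p.2 = 0 ∧ nextQueue q a τ p.1 p.2 = 0 := by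
  have hservice := switchService_le_one τ p.1 p.2
  have heq : unusedVec q a τ p = ((q p.1 p.2 + a p.1 p.2 - switchService τ p.1 p.2 : ℕ) : ℝ) -
      (q p.1 p.2 + a p.1 p.2 - switchService τ p.1 p.2) := by
    simp [unusedVec, queueVec_apply, serviceVec_apply, nextQueue]
  by_cases h : switchService τ p.1 p.2 ≤ q p.1 p.2 + a p.1 p.2
  · left
    rw [heq, Nat.cast_sub h]
    push_cast
    ring
  · right
    obtain ⟨hq, ha, hs⟩ : q p.1 p.2 = 0 ∧ a p.1 p.2 = 0 ∧ switchService τ p.1 p.2 = 1 := by omega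
    simp [heq, nextQueue, hq, ha, hs]

lemma unusedVec_nonneg (q a : SwitchState n) (τ : Equiv.Perm (Fin n)) (p : Fin n × Fin n) :
    0 ≤ unusedVec q a τ p := by
  rcases unusedVec_apply_eq_zero_or q a τ p with h | ⟨h, -⟩ <;> simp [h]

lemma inner_queueVec_unusedVec (q a : SwitchState n) (τ : Equiv.Perm (Fin n)) :
    ⟪queueVec q, unusedVec q a τ⟫ = 0 := by
  rw [PiLp.inner_apply]
  refine Finset.sum_eq_zero fun p _ => ?_
  rcases unusedVec_apply_eq_zero_or q a τ p with h | ⟨-, h, -⟩ <;> simp [h, queueVec_apply]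

lemma inner_queueVec_nextQueue_unusedVec (q a : SwitchState n) (τ : Equiv.Perm (Fin n)) :
    ⟪queueVec (nextQueue q a τ), unusedVec q a τ⟫ = 0 := by
  rw [PiLp.inner_apply]
  refine Finset.sum_eq_zero fun p _ => ?_
  rcases unusedVec_apply_eq_zero_or q a τ p with h | ⟨-, -, h⟩ <;> simp [h, queueVec_apply]

lemma norm_unusedVec_sq [NeZero n] (q a : SwitchState n) (τ : Equiv.Perm (Fin n)) :
    ‖unusedVec q a τ‖ ^ 2 = n * (⟪queueVec (nextQueue q a τ), matVec (uniformMatrix (Fin n))⟫ -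
      ⟪queueVec q, matVec (uniformMatrix (Fin n))⟫ -
      ⟪queueVec a, matVec (uniformMatrix (Fin n))⟫ + 1) := by
  have hn : (n : ℝ) ≠ 0 := NeZero.ne _
  have hservice : ⟪serviceVec τ, matVec (uniformMatrix (Fin n))⟫ = 1 :=
    inner_matVec_uniformMatrix_of_mem_doublyStochastic permMatrix_mem_doublyStochastic
  have hsum : ‖unusedVec q a τ‖ ^ 2 = ∑ p, unusedVec q a τ p := by
    rw [EuclideanSpace.norm_sq_eq]
    refine Finset.sum_congr rfl fun p _ => ?_
    rcases unusedVec_apply_eq_zero_or q a τ p with h | ⟨h, -⟩ <;> simp [h]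
  have hinner := inner_matVec_uniformMatrix (unusedVec q a τ)
  rw [← hsum, Fintype.card_fin, unusedVec, inner_sub_left, inner_sub_left, inner_add_left,
    hservice, ← unusedVec] at hinner
  field_simp at hinner
  linarith

lemma norm_queueVec_nextQueue_sub_le {amax : ℕ} (ha : ∀ i j, a i j ≤ amax) :
    ‖queueVec (nextQueue q a τ) - queueVec q‖ ≤ n * (amax + 1) := by
  have hcoord (p : Fin n × Fin n) :
      ‖(queueVec (nextQueue q a τ) - queueVec q) p‖ ≤ amax + 1 := by
    have hservice := switchService_le_one τ p.1 p.2
    have harrival := ha p.1 p.2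
    have hup : nextQueue q a τ p.1 p.2 ≤ q p.1 p.2 + (amax + 1) := by
      simp only [nextQueue]
      omega
    have hdown : q p.1 p.2 ≤ nextQueue q a τ p.1 p.2 + (amax + 1) := by
      simp only [nextQueue]
      omega
    rw [PiLp.sub_apply, Real.norm_eq_abs, abs_sub_le_iff, queueVec_apply, queueVec_apply,
      sub_le_iff_le_add', sub_le_iff_le_add']
    exact_mod_cast And.intro hup hdown
  refine (sq_le_sq₀ (norm_nonneg _) (by positivity)).1 ?_
  rw [EuclideanSpace.norm_sq_eq]
  calc ∑ p, ‖(queueVec (nextQueue q a τ) - queueVec q) p‖ ^ 2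
      ≤ ∑ _ : Fin n × Fin n, ((amax : ℝ) + 1) ^ 2 := by gcongr with p; exact hcoord p
    _ = (n * (amax + 1) : ℝ) ^ 2 := by simp; ring

lemma norm_queueVec_nextQueue_sub_sq_le {amax : ℕ} (ha : ∀ i j, a i j ≤ amax)
    {k : EuclideanSpace ℝ (Fin n × Fin n)} (hk : ∀ p, 0 ≤ k p) :
    ‖queueVec (nextQueue q a τ) - k‖ ^ 2 ≤ ‖queueVec q - k‖ ^ 2 +
      2 * ⟪queueVec q - k, queueVec a - serviceVec τ⟫ + (n * (amax + 1)) ^ 2 := by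
  have hunused : ⟪queueVec q - k, unusedVec q a τ⟫ ≤ 0 := by
    rw [inner_sub_left, inner_queueVec_unusedVec, zero_sub, neg_nonpos, PiLp.inner_apply]
    exact Finset.sum_nonneg fun p _ => mul_nonneg (unusedVec_nonneg q a τ p) (hk p)
  have hjump : queueVec (nextQueue q a τ) - queueVec q =
      queueVec a - serviceVec τ + unusedVec q a τ := by
    rw [queueVec_nextQueue]
    abel
  calc ‖queueVec (nextQueue q a τ) - k‖ ^ 2
      = ‖(queueVec q - k) + (queueVec (nextQueue q a τ) - queueVec q)‖ ^ 2 := by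
        rw [sub_add_sub_comm, add_comm (queueVec q), add_sub_add_right_eq_sub]
    _ ≤ _ := by
        have := norm_queueVec_nextQueue_sub_le (q := q) (τ := τ) ha
        rw [norm_add_sq_real, hjump, inner_add_right, ← hjump]
        gcongr
        exact add_le_of_nonpos_right hunused

end SwitchVectors

section Arrivals

variable {n : ℕ} {A : PMF (SwitchState n)} {amax : ℕ} {rate : Matrix (Fin n) (Fin n) ℝ}

lemma IsArrivalLaw.finite_support (hA : IsArrivalLaw A amax rate) : A.support.Finite :=
  (Set.finite_Iic (fun _ _ => amax : SwitchState n)).subset fun a ha i j => hA.bounded a ha i j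

lemma IsArrivalLaw.integrable (hA : IsArrivalLaw A amax rate) (f : SwitchState n → ℝ) :
    Integrable f A.toMeasure :=
  integrable_toMeasure_of_finite_support hA.finite_support f

lemma IsArrivalLaw.integral_inner_queueVec (hA : IsArrivalLaw A amax rate)
    (x : EuclideanSpace ℝ (Fin n × Fin n)) :
    ∫ a, ⟪x, queueVec a⟫ ∂A.toMeasure = ⟪x, matVec rate⟫ := by
  simp only [queueVec, inner_matVec_right]
  rw [integral_finsetSum _ fun i _ => hA.integrable _]
  refine Finset.sum_congr rfl fun i _ => ?_
  rw [integral_finsetSum _ fun j _ => hA.integrable _]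
  refine Finset.sum_congr rfl fun j _ => ?_
  rw [integral_mul_const]
  exact congrArg (· * x (i, j)) (hA.mean i j)

lemma IsArrivalLaw.apply_zero_ne_zero (hA : IsArrivalLaw A amax rate)
    (hrate : ∀ i j, rate i j < 1) : A 0 ≠ 0 := by
  have hfiber : (⋂ p ∈ (Finset.univ : Finset (Fin n × Fin n)),
      (fun a : SwitchState n => a p.1 p.2) ⁻¹' {0}) = {0} := by
    ext a
    simp only [Finset.mem_univ, Set.iInter_true, Set.mem_iInter, Set.mem_preimage,
      Set.mem_singleton_iff, Prod.forall]
    exact ⟨fun h => funext fun i => funext fun j => h i j, fun h i j => by rw [h]; rfl⟩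
  have hprod := hA.indep.measure_inter_preimage_eq_mul Finset.univ (sets := fun _ => {0})
    (fun _ _ => MeasurableSet.of_discrete)
  rw [hfiber, A.toMeasure_apply_singleton _ MeasurableSet.of_discrete] at hprod
  rw [hprod, Finset.prod_ne_zero_iff]
  rintro ⟨i, j⟩ _ hzero
  rw [A.toMeasure_apply_eq_zero_iff MeasurableSet.of_discrete, Set.disjoint_left] at hzero
  have hmean : ∫ _, (1 : ℝ) ∂A.toMeasure ≤ ∫ a, (a i j : ℝ) ∂A.toMeasure :=
    integral_toMeasure_mono (hA.integrable _) (hA.integrable _) fun a ha => by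
      exact_mod_cast Nat.one_le_iff_ne_zero.2 (hzero ha)
  rw [hA.mean i j, integral_const, probReal_univ, smul_eq_mul, mul_one] at hmean
  exact absurd (hrate i j) (not_lt.2 hmean)

lemma IsArrivalLaw.integral_norm_queueVec_nextQueue_sub_sq_le (hA : IsArrivalLaw A amax rate)
    {q : SwitchState n} {τ : Equiv.Perm (Fin n)} {k : EuclideanSpace ℝ (Fin n × Fin n)}
    (hk : ∀ p, 0 ≤ k p) :
    ∫ a, ‖queueVec (nextQueue q a τ) - k‖ ^ 2 ∂A.toMeasure ≤ ‖queueVec q - k‖ ^ 2 +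
      2 * ⟪queueVec q - k, matVec rate - serviceVec τ⟫ + (n * (amax + 1)) ^ 2 := by
  calc _ ≤ ∫ a, (2 * ⟪queueVec q - k, queueVec a⟫ + (‖queueVec q - k‖ ^ 2 -
        2 * ⟪queueVec q - k, serviceVec τ⟫ + (n * (amax + 1)) ^ 2)) ∂A.toMeasure :=
      integral_toMeasure_mono (hA.integrable _) (hA.integrable _) fun a ha =>
        (norm_queueVec_nextQueue_sub_sq_le (hA.bounded a ha) hk).trans_eq <| by
          rw [inner_sub_right]
          ring
    _ = _ := by
      rw [integral_add (hA.integrable _) (hA.integrable _), integral_const_mul,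
        hA.integral_inner_queueVec, integral_const, probReal_univ, one_smul, inner_sub_right]
      ring

end Arrivals

section Step

variable {n : ℕ} {A : PMF (SwitchState n)} {S : SwitchState n → PMF (Equiv.Perm (Fin n))}

lemma mem_support_switchStep {q q' : SwitchState n} : q' ∈ (switchStep A S q).support ↔
    ∃ τ ∈ (S q).support, ∃ a ∈ A.support, nextQueue q a τ = q' := by
  simp [switchStep]

lemma finite_support_switchStep (hA : A.support.Finite) (q : SwitchState n) :
    (switchStep A S q).support.Finite := by
  refine finite_support_bind (Set.toFinite _) fun τ => ?_
  rw [PMF.support_map]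
  exact hA.image _

lemma integral_switchStep_le (hA : A.support.Finite) {f : SwitchState n → ℝ} {q : SwitchState n}
    {c : ℝ} (h : ∀ τ ∈ (S q).support, ∫ a, f (nextQueue q a τ) ∂A.toMeasure ≤ c) :
    ∫ q', f q' ∂(switchStep A S q).toMeasure ≤ c := by
  let _ : MeasurableSpace (Equiv.Perm (Fin n)) := ⊤
  have : DiscreteMeasurableSpace (Equiv.Perm (Fin n)) := ⟨fun _ => trivial⟩
  have hfin (g : Equiv.Perm (Fin n) → ℝ) : Integrable g (S q).toMeasure :=
    integrable_toMeasure_of_finite_support (Set.toFinite _) g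
  have hmap (τ : Equiv.Perm (Fin n)) : ∫ q', f q' ∂(A.map fun a => nextQueue q a τ).toMeasure =
      ∫ a, f (nextQueue q a τ) ∂A.toMeasure := by
    rw [← PMF.toMeasure_map (p := A) (hf := Measurable.of_discrete),
      integral_map Measurable.of_discrete.aemeasurable .of_discrete]
  calc ∫ q', f q' ∂(switchStep A S q).toMeasure
      = ∫ τ, ∫ a, f (nextQueue q a τ) ∂A.toMeasure ∂(S q).toMeasure := by
        rw [switchStep, integral_toMeasure_bind
          (integrable_toMeasure_of_finite_support (finite_support_switchStep hA q) f)]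
        simp only [hmap]
    _ ≤ ∫ _, c ∂(S q).toMeasure := integral_toMeasure_mono (hfin _) (hfin _) h
    _ = c := by simp

variable {Q : PMF (SwitchState n)} {f g h k : SwitchState n → ℝ}

lemma IsStationaryLaw.integral_le (hQ : IsStationaryLaw A S Q) (hA : A.support.Finite)
    (hf : Integrable f Q.toMeasure) (hg : Integrable g Q.toMeasure)
    (hfg : ∀ q, ∀ τ ∈ (S q).support, ∫ a, f (nextQueue q a τ) ∂A.toMeasure ≤ g q) :
    ∫ q, f q ∂Q.toMeasure ≤ ∫ q, g q ∂Q.toMeasure := by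
  have hf' : Integrable f (Q.bind (switchStep A S)).toMeasure := by rwa [hQ]
  have hstep := integral_toMeasure_bind hf'
  rw [hQ] at hstep
  rw [hstep]
  exact integral_mono (integrable_integral_of_bind hf') hg fun q =>
    integral_switchStep_le hA (hfg q)

lemma IsStationaryLaw.abs_integral_sub_integral_le (hQ : IsStationaryLaw A S Q)
    (hA : A.support.Finite) (hf : Integrable f Q.toMeasure) (hg : Integrable g Q.toMeasure)
    (hh : Integrable h Q.toMeasure) (hk : Integrable k Q.toMeasure)
    (hle : ∀ q, ∀ τ ∈ (S q).support, |∫ a, f (nextQueue q a τ) ∂A.toMeasure - g q| ≤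
      ∫ a, h (nextQueue q a τ) ∂A.toMeasure - k q) :
    |∫ q, f q ∂Q.toMeasure - ∫ q, g q ∂Q.toMeasure| ≤
      ∫ q, h q ∂Q.toMeasure - ∫ q, k q ∂Q.toMeasure := by
  have hint (φ : SwitchState n → ℝ) : Integrable φ A.toMeasure :=
    integrable_toMeasure_of_finite_support hA φ
  have hupper := hQ.integral_le hA (hf.sub hh) (hg.sub hk) fun q τ hτ => by
    simp only [Pi.sub_apply]
    rw [integral_sub (hint _) (hint _)]
    linarith [(abs_le.1 (hle q τ hτ)).2]
  have hlower := hQ.integral_le hA (hf.add hh).neg (hg.add hk).neg fun q τ hτ => by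
    simp only [Pi.neg_apply, Pi.add_apply]
    rw [integral_neg, integral_add (hint _) (hint _)]
    linarith [(abs_le.1 (hle q τ hτ)).1]
  rw [integral_sub' hf hh, integral_sub' hg hk] at hupper
  rw [integral_neg', integral_neg', integral_add' hf hh, integral_add' hg hk] at hlower
  exact abs_le.2 ⟨by linarith, by linarith⟩

end Step

section Draining

variable {n : ℕ} {A : PMF (SwitchState n)} {S : SwitchState n → PMF (Equiv.Perm (Fin n))}
  {q : SwitchState n}

lemma sum_nextQueue_zero_le (hS : IsMaxWeight S) {τ : Equiv.Perm (Fin n)}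
    (hτ : τ ∈ (S q).support) {N : ℕ} (hq : ∑ i, ∑ j, q i j ≤ N + 1) :
    ∑ i, ∑ j, nextQueue q 0 τ i j ≤ N := by
  have hle (i j : Fin n) : nextQueue q 0 τ i j ≤ q i j := by simp [nextQueue]
  by_cases hempty : ∀ i j, q i j = 0
  · have (i j : Fin n) : nextQueue q 0 τ i j = 0 := by simpa [hempty] using hle i j
    simp [this]
  push Not at hempty
  obtain ⟨i, j, hij⟩ := hempty
  have hswap : 0 < scheduleWeight q (Equiv.swap i j) := by
    refine Finset.sum_pos' (fun _ _ => Nat.zero_le _) ⟨i, Finset.mem_univ _, ?_⟩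
    refine Finset.sum_pos' (fun _ _ => Nat.zero_le _) ⟨j, Finset.mem_univ _, ?_⟩
    simpa [switchService] using Nat.pos_of_ne_zero hij
  obtain ⟨k, -, hk⟩ :=
    Finset.exists_ne_zero_of_sum_ne_zero (hswap.trans_le (hS q τ hτ _)).ne'
  obtain ⟨l, -, hl⟩ := Finset.exists_ne_zero_of_sum_ne_zero hk
  have hserved : nextQueue q 0 τ k l < q k l := by
    have hqueue := Nat.pos_of_ne_zero (left_ne_zero_of_mul hl)
    have hservice := Nat.pos_of_ne_zero (right_ne_zero_of_mul hl)
    simp only [nextQueue, Pi.zero_apply]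
    omega
  have hlt : ∑ i, ∑ j, nextQueue q 0 τ i j < ∑ i, ∑ j, q i j :=
    Finset.sum_lt_sum (fun i _ => Finset.sum_le_sum fun j _ => hle i j) ⟨k, Finset.mem_univ _,
      Finset.sum_lt_sum (fun j _ => hle k j) ⟨l, Finset.mem_univ _, hserved⟩⟩
  omega

lemma pow_le_chainLaw_zero (hS : IsMaxWeight S) {N : ℕ} (hq : ∑ i, ∑ j, q i j ≤ N) :
    A 0 ^ N ≤ chainLaw (switchStep A S) q N 0 := by
  induction N generalizing q with
  | zero =>
    have : q = 0 := by
      ext i j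
      simp only [nonpos_iff_eq_zero, Finset.sum_eq_zero_iff, Finset.mem_univ,
        true_imp_iff] at hq
      exact hq i j
    simp [chainLaw, this]
  | succ N ih =>
    have hstep (τ : Equiv.Perm (Fin n)) : S q τ * A 0 ^ (N + 1) ≤ S q τ *
        ((A.map fun a => nextQueue q a τ).bind fun q' => chainLaw (switchStep A S) q' N) 0 := by
      rcases eq_or_ne (S q τ) 0 with hτ | hτ
      · simp [hτ]
      rw [PMF.bind_map, PMF.bind_apply, pow_succ']
      gcongr
      exact le_trans (mul_le_mul_right (ih (sum_nextQueue_zero_le hS hτ hq)) _)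
        (ENNReal.le_tsum (f := fun a => A a *
          ((fun q' => chainLaw (switchStep A S) q' N) ∘ fun a => nextQueue q a τ) a 0) 0)
    calc A 0 ^ (N + 1) = ∑' τ, S q τ * A 0 ^ (N + 1) := by
          rw [ENNReal.tsum_mul_right, (S q).tsum_coe, one_mul]
      _ ≤ _ := ENNReal.tsum_le_tsum hstep
      _ = chainLaw (switchStep A S) q (N + 1) 0 := by
          rw [chainLaw_succ', switchStep, PMF.bind_bind, PMF.bind_apply]

lemma isUniformlyAccessible_zero (hS : IsMaxWeight S) (hA0 : A 0 ≠ 0) {V : SwitchState n → ℝ}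
    (hV : ∀ L, {q | V q ≤ L}.Finite) : IsUniformlyAccessible (switchStep A S) V 0 := by
  intro L
  obtain ⟨N₀, hN₀⟩ := ((hV L).image fun q => ∑ i, ∑ j, q i j).bddAbove
  refine ⟨N₀, fun N hN => ⟨((A 0) ^ N).toReal, ?_, fun q hq => ?_⟩⟩
  · exact ENNReal.toReal_pos (pow_ne_zero _ hA0) (ENNReal.pow_ne_top (A.apply_ne_top 0))
  · exact ENNReal.toReal_mono (PMF.apply_ne_top _ _)
      (pow_le_chainLaw_zero hS ((hN₀ (Set.mem_image_of_mem _ hq)).trans hN))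

lemma queueLaw_eq_chainLaw (q₀ : SwitchState n) (t : ℕ) :
    queueLaw A S q₀ t = chainLaw (switchStep A S) q₀ t := by
  induction t with
  | zero => rfl
  | succ t ih => rw [queueLaw, ih, chainLaw]

end Draining

section Drift

variable {n : ℕ} {A : PMF (SwitchState n)} {S : SwitchState n → PMF (Equiv.Perm (Fin n))}
  {amax : ℕ} {ν : Matrix (Fin n) (Fin n) ℝ} {δ ε : ℝ}

lemma integral_norm_queueVec_sq_switchStep_le (hS : IsMaxWeight S)
    (hν : ν ∈ doublyStochastic ℝ (Fin n)) (hδ : 0 ≤ δ) (hνδ : ∀ i j, δ ≤ ν i j) (hε : 0 ≤ ε)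
    (hA : IsArrivalLaw A amax (ν - ε • ν)) (q : SwitchState n) :
    ∫ q', ‖queueVec q'‖ ^ 2 ∂(switchStep A S q).toMeasure ≤
      ‖queueVec q‖ ^ 2 - 2 * (ε * δ) * ‖queueVec q‖ + (n * (amax + 1)) ^ 2 := by
  refine integral_switchStep_le hA.finite_support fun τ hτ => ?_
  have hstep := hA.integral_norm_queueVec_nextQueue_sub_sq_le (q := q) (τ := τ)
    (k := 0) fun _ => le_rfl
  have hweight := inner_matVec_le_of_isMaxWeight hS hτ hν
  have hload : δ * ‖queueVec q‖ ≤ ⟪queueVec q, matVec ν⟫ := by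
    have hnorm : ‖queueVec q‖ ≤ ∑ p, queueVec q p := by
      refine (sq_le_sq₀ (norm_nonneg _) (Finset.sum_nonneg fun p _ => queueVec_nonneg q p)).1 ?_
      rw [EuclideanSpace.real_norm_sq_eq]
      exact Finset.sum_sq_le_sq_sum_of_nonneg fun p _ => queueVec_nonneg q p
    calc δ * ‖queueVec q‖ ≤ δ * ∑ p, queueVec q p := by gcongr
      _ ≤ ⟪queueVec q, matVec ν⟫ := by
        rw [inner_matVec_right, Finset.mul_sum, Fintype.sum_prod_type]
        gcongr with i _ j
        · exact queueVec_nonneg q _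
        · exact hνδ i j
  simp only [sub_zero, map_sub, map_smul, inner_sub_right, inner_smul_right] at hstep
  have := mul_le_mul_of_nonneg_left hload hε
  linarith

lemma integral_infDist_sq_switchStep_le (hS : IsMaxWeight S)
    (hν : ν ∈ doublyStochastic ℝ (Fin n)) (hδ : 0 ≤ δ) (hνδ : ∀ i j, δ ≤ ν i j) (hε : 0 ≤ ε)
    (hεδ : 2 * ε * ‖matVec ν‖ ≤ δ) (hA : IsArrivalLaw A amax (ν - ε • ν)) (q : SwitchState n) :
    ∫ q', Metric.infDist (queueVec q') (collapseCone (Fin n) (Fin n)) ^ 2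
        ∂(switchStep A S q).toMeasure ≤
      Metric.infDist (queueVec q) (collapseCone (Fin n) (Fin n)) ^ 2 -
        δ * Metric.infDist (queueVec q) (collapseCone (Fin n) (Fin n)) +
        (n * (amax + 1)) ^ 2 := by
  refine integral_switchStep_le hA.finite_support fun τ hτ => ?_
  obtain ⟨k, hk, hdist, -, -⟩ := exists_mem_infDist_eq_norm_sub _
    (isClosed_collapseCone (ι := Fin n) (κ := Fin n)) (queueVec q)
  have hstep := hA.integral_norm_queueVec_nextQueue_sub_sq_le (q := q) (τ := τ) hk.2
  have hweight := inner_matVec_add_mul_infDist_le_of_isMaxWeight hS hτ hν hδ hνδ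
  have hmargin : ⟪k, matVec ν - serviceVec τ⟫ = 0 :=
    matVec_sub_mem_marginSpace_orthogonal hν permMatrix_mem_doublyStochastic k hk.1
  have hcauchy := (abs_le.1 (abs_real_inner_le_norm (queueVec q - k) (matVec ν))).1
  have hnext : ∫ a, Metric.infDist (queueVec (nextQueue q a τ)) (collapseCone (Fin n) (Fin n)) ^ 2
      ∂A.toMeasure ≤ ∫ a, ‖queueVec (nextQueue q a τ) - k‖ ^ 2 ∂A.toMeasure := by
    refine integral_mono (hA.integrable _) (hA.integrable _) fun a => ?_
    have := Metric.infDist_le_dist_of_mem (x := queueVec (nextQueue q a τ)) hk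
    rw [dist_eq_norm] at this
    exact pow_le_pow_left₀ Metric.infDist_nonneg this 2
  rw [hdist] at hweight ⊢
  have hslack : ε * (‖queueVec q - k‖ * ‖matVec ν‖) * 2 ≤ δ * ‖queueVec q - k‖ := by
    nlinarith [norm_nonneg (queueVec q - k)]
  simp only [map_sub, map_smul, inner_sub_left, inner_sub_right, inner_smul_right]
    at hstep hmargin hcauchy
  nlinarith

end Drift

section Stability

lemma exists_pos_forall_le {ι κ : Type*} [Finite ι] [Finite κ] {M : Matrix ι κ ℝ}
    (hM : ∀ i j, 0 < M i j) : ∃ δ > 0, ∀ i j, δ ≤ M i j := by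
  rcases isEmpty_or_nonempty (ι × κ) with h | h
  · exact ⟨1, one_pos, fun i j => h.elim (i, j)⟩
  · obtain ⟨p, hp⟩ := Finite.exists_min fun p : ι × κ => M p.1 p.2
    exact ⟨M p.1 p.2, hM _ _, fun i j => hp (i, j)⟩

lemma integrable_sq_and_integral_sq_le_of_integrable_exp_mul {Ω : Type*} [MeasurableSpace Ω]
    {μ : Measure Ω} {f : Ω → ℝ} (hf : AEStronglyMeasurable f μ) (hf0 : ∀ ω, 0 ≤ f ω) {θ : ℝ}
    (hθ : 0 < θ) (h : Integrable (fun ω => Real.exp (θ * f ω)) μ) :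
    Integrable (fun ω => f ω ^ 2) μ ∧
      ∫ ω, f ω ^ 2 ∂μ ≤ 2 / θ ^ 2 * ∫ ω, Real.exp (θ * f ω) ∂μ := by
  have hle (ω : Ω) : f ω ^ 2 ≤ 2 / θ ^ 2 * Real.exp (θ * f ω) := by
    have hθf := mul_nonneg hθ.le (hf0 ω)
    have := Real.quadratic_le_exp_of_nonneg hθf
    rw [div_mul_eq_mul_div, le_div_iff₀ (by positivity)]
    nlinarith
  have hint : Integrable (fun ω => f ω ^ 2) μ :=
    (h.const_mul _).mono' (hf.pow 2) (ae_of_all _ fun ω => by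
      rw [Real.norm_of_nonneg (sq_nonneg _)]
      exact hle ω)
  refine ⟨hint, ?_⟩
  rw [← integral_const_mul]
  exact integral_mono hint (h.const_mul _) hle

variable {n : ℕ} {A : PMF (SwitchState n)} {S : SwitchState n → PMF (Equiv.Perm (Fin n))}
  {Q : PMF (SwitchState n)} {amax : ℕ} {ν : Matrix (Fin n) (Fin n) ℝ} {δ ε : ℝ}

lemma finite_setOf_exp_mul_norm_queueVec_le {θ : ℝ} (hθ : 0 < θ) (L : ℝ) :
    {q : SwitchState n | Real.exp (θ * ‖queueVec q‖) ≤ L}.Finite := by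
  refine (Set.finite_Iic (fun _ _ => ⌊L / θ⌋₊ : SwitchState n)).subset fun q hq i j => ?_
  have hcoord : (q i j : ℝ) ≤ ‖queueVec q‖ :=
    (le_abs_self _).trans (PiLp.norm_apply_le (queueVec q) (i, j))
  have hexp := (Real.add_one_le_exp (θ * ‖queueVec q‖)).trans hq
  refine Nat.le_floor (hcoord.trans ((le_div_iff₀ hθ).2 ?_))
  linarith

lemma norm_queueVec_sub_le_of_mem_support {rate : Matrix (Fin n) (Fin n) ℝ}
    (hA : IsArrivalLaw A amax rate) {q q' : SwitchState n}
    (hq' : q' ∈ (switchStep A S q).support) :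
    ‖queueVec q' - queueVec q‖ ≤ n * (amax + 1) := by
  obtain ⟨τ, -, a, ha, rfl⟩ := mem_support_switchStep.1 hq'
  exact norm_queueVec_nextQueue_sub_le (hA.bounded a ha)

lemma le_mul_add_one_of_mem_doublyStochastic [NeZero n]
    (hν : ν ∈ doublyStochastic ℝ (Fin n)) (hνδ : ∀ i j, δ ≤ ν i j) (amax : ℕ) :
    δ ≤ n * (amax + 1) := by
  have hn : (1 : ℝ) ≤ n := by exact_mod_cast NeZero.one_le
  have : (1 : ℝ) ≤ n * (amax + 1) := one_le_mul_of_one_le_of_one_le hn (by simp)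
  exact ((hνδ 0 0).trans (le_one_of_mem_doublyStochastic hν (i := 0) (j := 0))).trans this

lemma exists_hasGeometricDrift_exp_norm [NeZero n] (hS : IsMaxWeight S)
    (hν : ν ∈ doublyStochastic ℝ (Fin n)) (hν_pos : ∀ i j, 0 < ν i j) (hε : ε ∈ Set.Ioo 0 1)
    (hA : IsArrivalLaw A amax (ν - ε • ν)) : ∃ θ > 0, ∃ γ K,
      HasGeometricDrift (switchStep A S) (fun q => Real.exp (θ * ‖queueVec q‖)) γ K := by
  obtain ⟨δ, hδ, hνδ⟩ := exists_pos_forall_le hν_pos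
  have hεδ : 0 < ε * δ / 2 := half_pos (mul_pos hε.1 hδ)
  have hle : ε * δ / 2 ≤ n * (amax + 1) := by
    have := le_mul_add_one_of_mem_doublyStochastic hν hνδ amax
    nlinarith [hε.2]
  have hb := hεδ.trans_le hle
  refine ⟨_, by positivity, _, _, hasGeometricDrift_exp (V := fun q => ‖queueVec q‖) hεδ hle
    (fun q q' hq' => (abs_norm_sub_norm_le _ _).trans
      (norm_queueVec_sub_le_of_mem_support hA hq')) fun q => ?_⟩
  convert integral_norm_queueVec_sq_switchStep_le hS hν hδ.le hνδ hε.1.le hA q using 4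
  ring

lemma exists_hasGeometricDrift_exp_infDist [NeZero n] (hν : ν ∈ doublyStochastic ℝ (Fin n))
    (hδ : 0 < δ) (hνδ : ∀ i j, δ ≤ ν i j) (amax : ℕ) :
    ∃ θ > 0, ∃ γ K, ∀ (ε : ℝ) (A : PMF (SwitchState n)) (S : _ → PMF (Equiv.Perm (Fin n))),
      0 ≤ ε → 2 * ε * ‖matVec ν‖ ≤ δ → IsArrivalLaw A amax (ν - ε • ν) → IsMaxWeight S →
      HasGeometricDrift (switchStep A S) (fun q => Real.exp
        (θ * Metric.infDist (queueVec q) (collapseCone (Fin n) (Fin n)))) γ K := by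
  have hle : δ / 4 ≤ n * (amax + 1) := by
    have := le_mul_add_one_of_mem_doublyStochastic hν hνδ amax
    linarith
  have hb : (0 : ℝ) < n * (amax + 1) := (by positivity : 0 < δ / 4).trans_le hle
  refine ⟨δ / 4 / (2 * (n * (amax + 1)) ^ 2), by positivity, _, _, fun ε A S hε hεδ hA hS =>
    hasGeometricDrift_exp (by positivity) hle (fun q q' hq' => ?_) fun q => ?_⟩
  · refine le_trans ?_ (norm_queueVec_sub_le_of_mem_support hA hq')
    simpa [Real.dist_eq, dist_eq_norm] using (Metric.lipschitz_infDist_pt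
      (collapseCone (Fin n) (Fin n) : Set (EuclideanSpace ℝ (Fin n × Fin n)))).dist_le_mul
      (queueVec q') (queueVec q)
  · convert integral_infDist_sq_switchStep_le hS hν hδ.le hνδ hε hεδ hA q using 4
    ring

lemma exists_forall_tendsto_queueLaw [NeZero n] (hS : IsMaxWeight S)
    (hν : ν ∈ doublyStochastic ℝ (Fin n)) (hν_pos : ∀ i j, 0 < ν i j) (hε : ε ∈ Set.Ioo 0 1)
    (hA : IsArrivalLaw A amax (ν - ε • ν)) :
    ∃ Q : PMF (SwitchState n), ∀ q₀ q, Tendsto (fun t => queueLaw A S q₀ t q) atTop (𝓝 (Q q)) := by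
  obtain ⟨θ, hθ, γ, K, hdrift⟩ := exists_hasGeometricDrift_exp_norm hS hν hν_pos hε hA
  have hrate (i j : Fin n) : (ν - ε • ν) i j < 1 := by
    have := le_one_of_mem_doublyStochastic hν (i := i) (j := j)
    have := mul_pos hε.1 (hν_pos i j)
    simp only [Matrix.sub_apply, Matrix.smul_apply, smul_eq_mul]
    linarith
  have hlevel := finite_setOf_exp_mul_norm_queueVec_le (n := n) hθ
  simp only [queueLaw_eq_chainLaw]
  exact hdrift.exists_tendsto_pmf (finite_support_switchStep hA.finite_support)
    (isUniformlyAccessible_zero hS (hA.apply_zero_ne_zero hrate) hlevel) hlevel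

lemma existsUnique_isStationaryLaw [NeZero n] (hS : IsMaxWeight S)
    (hν : ν ∈ doublyStochastic ℝ (Fin n)) (hν_pos : ∀ i j, 0 < ν i j) (hε : ε ∈ Set.Ioo 0 1)
    (hA : IsArrivalLaw A amax (ν - ε • ν)) : ∃! Q, IsStationaryLaw A S Q := by
  obtain ⟨Q, hQ⟩ := exists_forall_tendsto_queueLaw hS hν hν_pos hε hA
  simp only [queueLaw_eq_chainLaw] at hQ
  exact ⟨Q, bind_eq_of_tendsto_chainLaw (hQ 0), fun Q' hQ' => eq_of_tendsto_chainLaw hQ hQ'⟩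

lemma IsStationaryLaw.tendsto_queueLaw [NeZero n] (hQ : IsStationaryLaw A S Q)
    (hS : IsMaxWeight S) (hν : ν ∈ doublyStochastic ℝ (Fin n)) (hν_pos : ∀ i j, 0 < ν i j)
    (hε : ε ∈ Set.Ioo 0 1) (hA : IsArrivalLaw A amax (ν - ε • ν)) (q₀ q : SwitchState n) :
    Tendsto (fun t => queueLaw A S q₀ t q) atTop (𝓝 (Q q)) := by
  obtain ⟨Q', hQ'⟩ := exists_forall_tendsto_queueLaw hS hν hν_pos hε hA
  simp only [queueLaw_eq_chainLaw] at hQ' ⊢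
  rw [eq_of_tendsto_chainLaw hQ' hQ]
  exact hQ' q₀ q

lemma IsStationaryLaw.integrable_and_integral_le_of_hasGeometricDrift [NeZero n]
    (hQ : IsStationaryLaw A S Q) (hS : IsMaxWeight S) (hν : ν ∈ doublyStochastic ℝ (Fin n))
    (hν_pos : ∀ i j, 0 < ν i j) (hε : ε ∈ Set.Ioo 0 1) (hA : IsArrivalLaw A amax (ν - ε • ν))
    {V : SwitchState n → ℝ} {γ K : ℝ} (hV : HasGeometricDrift (switchStep A S) V γ K) :
    Integrable V Q.toMeasure ∧ ∫ q, V q ∂Q.toMeasure ≤ V 0 + K / (1 - γ) :=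
  hV.integrable_and_integral_le (finite_support_switchStep hA.finite_support) fun q => by
    simpa only [queueLaw_eq_chainLaw] using hQ.tendsto_queueLaw hS hν hν_pos hε hA 0 q

lemma IsStationaryLaw.memLp_queueVec [NeZero n] (hQ : IsStationaryLaw A S Q)
    (hS : IsMaxWeight S) (hν : ν ∈ doublyStochastic ℝ (Fin n)) (hν_pos : ∀ i j, 0 < ν i j)
    (hε : ε ∈ Set.Ioo 0 1) (hA : IsArrivalLaw A amax (ν - ε • ν)) :
    MemLp queueVec 2 Q.toMeasure := by
  obtain ⟨θ, hθ, γ, K, hdrift⟩ := exists_hasGeometricDrift_exp_norm hS hν hν_pos hε hA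
  rw [memLp_two_iff_integrable_sq_norm .of_discrete]
  exact (integrable_sq_and_integral_sq_le_of_integrable_exp_mul .of_discrete
    (fun _ => norm_nonneg _) hθ
    (hQ.integrable_and_integral_le_of_hasGeometricDrift hS hν hν_pos hε hA hdrift).1).1

theorem exists_forall_integral_infDist_sq_le [NeZero n] (hν : ν ∈ doublyStochastic ℝ (Fin n))
    (hν_pos : ∀ i j, 0 < ν i j) (amax : ℕ) :
    ∃ ε₀ > (0 : ℝ), ∃ B, ∀ ε ∈ Set.Ioo 0 ε₀, ∀ (A : PMF (SwitchState n))
      (S : _ → PMF (Equiv.Perm (Fin n))) (Q : PMF (SwitchState n)),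
      IsArrivalLaw A amax (ν - ε • ν) → IsMaxWeight S → IsStationaryLaw A S Q →
      ∫ q, Metric.infDist (queueVec q) (collapseCone (Fin n) (Fin n)) ^ 2 ∂Q.toMeasure ≤ B := by
  obtain ⟨δ, hδ, hνδ⟩ := exists_pos_forall_le hν_pos
  obtain ⟨θ, hθ, γ, K, hdrift⟩ := exists_hasGeometricDrift_exp_infDist hν hδ hνδ amax
  refine ⟨min 1 (δ / (2 * (‖matVec ν‖ + 1))), by positivity, 2 / θ ^ 2 * (1 + K / (1 - γ)),
    fun ε hε A S Q hA hS hQ => ?_⟩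
  obtain ⟨hε1, hεδ⟩ := lt_min_iff.1 hε.2
  rw [lt_div_iff₀ (by positivity)] at hεδ
  have hV := hdrift ε A S hε.1.le (by nlinarith [hε.1]) hA hS
  obtain ⟨hint, hle⟩ :=
    hQ.integrable_and_integral_le_of_hasGeometricDrift hS hν hν_pos ⟨hε.1, hε1⟩ hA hV
  refine (integrable_sq_and_integral_sq_le_of_integrable_exp_mul .of_discrete
    (fun _ => Metric.infDist_nonneg) hθ hint).2.trans ?_
  have hzero : Metric.infDist (queueVec (0 : SwitchState n)) (collapseCone (Fin n) (Fin n)) = 0 :=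
    Metric.infDist_zero_of_mem (queueVec_zero (n := n) ▸ zero_mem (collapseCone (Fin n) (Fin n)))
  rw [hzero, mul_zero, Real.exp_zero] at hle
  gcongr

end Stability

section Fluctuations

lemma integral_norm_add_sum_smul_sq {Ω ι F : Type*} [MeasurableSpace Ω] [Fintype ι]
    [NormedAddCommGroup F] [InnerProductSpace ℝ F] {μ : Measure Ω} [IsProbabilityMeasure μ]
    {Y : ι → Ω → ℝ} (hY : ∀ i, MemLp (Y i) 2 μ)
    (hcov : Pairwise fun i j => cov[Y i, Y j; μ] = 0) (c : F) (v : ι → F) :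
    ∫ ω, ‖c + ∑ i, (Y i ω - μ[Y i]) • v i‖ ^ 2 ∂μ = ‖c‖ ^ 2 + ∑ i, Var[Y i; μ] * ‖v i‖ ^ 2 := by
  have hZ (i : ι) : MemLp (fun ω => Y i ω - μ[Y i]) 2 μ := (hY i).sub (memLp_const _)
  have hZ0 (i : ι) : ∫ ω, (Y i ω - μ[Y i]) ∂μ = 0 := by
    rw [integral_sub ((hY i).integrable one_le_two) (integrable_const _)]
    simp
  have hlin (i : ι) : Integrable (fun ω => (Y i ω - μ[Y i]) * ⟪c, v i⟫) μ :=
    ((hZ i).integrable one_le_two).mul_const _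
  have hquad (i j : ι) :
      Integrable (fun ω => (Y i ω - μ[Y i]) * (Y j ω - μ[Y j]) * ⟪v i, v j⟫) μ :=
    ((hZ i).integrable_mul (hZ j)).mul_const _
  have hexpand (ω : Ω) : ‖c + ∑ i, (Y i ω - μ[Y i]) • v i‖ ^ 2 =
      ‖c‖ ^ 2 + 2 * ∑ i, (Y i ω - μ[Y i]) * ⟪c, v i⟫ +
        ∑ i, ∑ j, (Y i ω - μ[Y i]) * (Y j ω - μ[Y j]) * ⟪v i, v j⟫ := by
    rw [norm_add_sq_real, ← real_inner_self_eq_norm_sq (∑ i, _), inner_sum, sum_inner]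
    simp only [inner_sum, real_inner_smul_left, real_inner_smul_right, mul_assoc]
    exact congrArg _ (Finset.sum_congr rfl fun i _ => Finset.sum_congr rfl fun j _ =>
      mul_left_comm _ _ _)
  have hcovsum (i : ι) : ∑ j, cov[Y i, Y j; μ] * ⟪v i, v j⟫ = Var[Y i; μ] * ‖v i‖ ^ 2 := by
    rw [Finset.sum_eq_single i (fun j _ hji => by rw [hcov hji.symm, zero_mul]) (by simp),
      covariance_self (hY i).aemeasurable, real_inner_self_eq_norm_sq]
  simp only [hexpand]
  rw [integral_add (by fun_prop) (by fun_prop), integral_add (by fun_prop) (by fun_prop),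
    integral_const_mul, integral_finsetSum _ fun i _ => hlin i,
    integral_finsetSum _ fun i _ => integrable_finsetSum _ fun j _ => hquad i j]
  simp only [integral_mul_const, hZ0, zero_mul, Finset.sum_const_zero, mul_zero, add_zero,
    integral_finsetSum _ fun j _ => hquad _ j, integral_const, probReal_univ, one_smul]
  exact congrArg _ (Finset.sum_congr rfl fun i _ => hcovsum i)

variable {n : ℕ} {A : PMF (SwitchState n)} {amax : ℕ} {rate ν : Matrix (Fin n) (Fin n) ℝ} {ε : ℝ}

lemma IsArrivalLaw.integral_norm_add_map_queueVec_sq {F : Type*} [NormedAddCommGroup F]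
    [InnerProductSpace ℝ F] (hA : IsArrivalLaw A amax rate)
    (T : EuclideanSpace ℝ (Fin n × Fin n) →ₗ[ℝ] F) (c : F) :
    ∫ a, ‖c + T (queueVec a)‖ ^ 2 ∂A.toMeasure = ‖c + T (matVec rate)‖ ^ 2 +
      ∑ p : Fin n × Fin n, Var[fun a => (a p.1 p.2 : ℝ); A.toMeasure] *
        ‖T (EuclideanSpace.single p 1)‖ ^ 2 := by
  have hmem (p : Fin n × Fin n) : MemLp (fun a : SwitchState n => (a p.1 p.2 : ℝ)) 2
      A.toMeasure :=
    (memLp_two_iff_integrable_sq .of_discrete).2 (hA.integrable _)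
  have hcov : Pairwise fun p p' : Fin n × Fin n =>
      cov[fun a => (a p.1 p.2 : ℝ), fun a => (a p'.1 p'.2 : ℝ); A.toMeasure] = 0 := fun p p' h =>
    ((hA.indep.indepFun h).comp (φ := fun k : ℕ => (k : ℝ)) (ψ := fun k : ℕ => (k : ℝ))
      .of_discrete .of_discrete).covariance_eq_zero (hmem p) (hmem p')
  have hbasis (x : EuclideanSpace ℝ (Fin n × Fin n)) :
      x = ∑ p, x p • EuclideanSpace.single p (1 : ℝ) := by
    ext p
    simp [Finset.sum_apply, Pi.single_apply]
  rw [← integral_norm_add_sum_smul_sq hmem hcov]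
  refine integral_congr_ae (ae_of_all _ fun a => ?_)
  simp only [hA.mean]
  have hdecomp : ∑ p : Fin n × Fin n, ((a p.1 p.2 : ℝ) - rate p.1 p.2) •
      T (EuclideanSpace.single p 1) = T (queueVec a) - T (matVec rate) := by
    rw [← map_sub, hbasis (queueVec a - matVec rate), map_sum]
    simp only [map_smul, PiLp.sub_apply, queueVec_apply, matVec_apply]
  rw [hdecomp, add_assoc, add_sub_cancel]

lemma IsArrivalLaw.integral_norm_starProjection_sq [NeZero n]
    (hA : IsArrivalLaw A amax (ν - ε • ν)) (hν : ν ∈ doublyStochastic ℝ (Fin n))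
    (q : SwitchState n) (τ : Equiv.Perm (Fin n)) :
    ∫ a, ‖(marginSpace (Fin n) (Fin n)).starProjection
        (queueVec q + queueVec a - serviceVec τ)‖ ^ 2 ∂A.toMeasure =
      ‖(marginSpace (Fin n) (Fin n)).starProjection (queueVec q)‖ ^ 2 -
        2 * ε * ⟪queueVec q, matVec (uniformMatrix (Fin n))⟫ + (ε ^ 2 + (2 * n - 1) / n ^ 2 *
        ∑ i, ∑ j, Var[fun a => (a i j : ℝ); A.toMeasure]) := by
  set P := (marginSpace (Fin n) (Fin n)).starProjection
  set J := matVec (uniformMatrix (Fin n))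
  have hn : (n : ℝ) ≠ 0 := NeZero.ne _
  have hPν : P (matVec ν) = J := starProjection_marginSpace_matVec hν
  have hPτ : P (serviceVec τ) = J :=
    starProjection_marginSpace_matVec permMatrix_mem_doublyStochastic
  have hPJ : P J = J := starProjection_marginSpace_matVec uniformMatrix_mem_doublyStochastic
  have hsplit (a : SwitchState n) : P (queueVec q + queueVec a - serviceVec τ) =
      (P (queueVec q) - J) + P (queueVec a) := by
    rw [map_sub, map_add, hPτ]
    abel
  have hmean : (P (queueVec q) - J) + P (matVec (ν - ε • ν)) = P (queueVec q) - ε • J := by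
    rw [map_sub, map_smul, map_sub, map_smul, hPν]
    abel
  have hinner : ⟪P (queueVec q), J⟫ = ⟪queueVec q, J⟫ := by
    rw [Submodule.inner_starProjection_left_eq_right, hPJ]
  have hvar (p : Fin n × Fin n) : ‖P (EuclideanSpace.single p 1)‖ ^ 2 = (2 * n - 1) / n ^ 2 := by
    rw [norm_starProjection_marginSpace_single_sq, Fintype.card_fin]
    field_simp
    ring
  simp only [hsplit]
  refine (hA.integral_norm_add_map_queueVec_sq P.toLinearMap _).trans ?_
  simp only [ContinuousLinearMap.coe_coe, hvar]
  rw [hmean, norm_sub_sq_real, inner_smul_right, hinner, norm_smul, norm_matVec_uniformMatrix,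
    ← Finset.sum_mul, Fintype.sum_prod_type, Real.norm_eq_abs, mul_one, sq_abs]
  ring

lemma IsArrivalLaw.integral_norm_unusedVec_sq [NeZero n]
    (hA : IsArrivalLaw A amax (ν - ε • ν)) (hν : ν ∈ doublyStochastic ℝ (Fin n))
    (q : SwitchState n) (τ : Equiv.Perm (Fin n)) :
    ∫ a, ‖unusedVec q a τ‖ ^ 2 ∂A.toMeasure =
      n * ∫ a, ⟪queueVec (nextQueue q a τ), matVec (uniformMatrix (Fin n))⟫ ∂A.toMeasure -
        n * (⟪queueVec q, matVec (uniformMatrix (Fin n))⟫ - ε) := by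
  set J := matVec (uniformMatrix (Fin n))
  have harrivals : ∫ a, ⟪queueVec a, J⟫ ∂A.toMeasure = 1 - ε := by
    have hνJ : ⟪J, matVec ν⟫ = 1 := by
      rw [real_inner_comm]
      exact inner_matVec_uniformMatrix_of_mem_doublyStochastic hν
    simp only [real_inner_comm J]
    rw [hA.integral_inner_queueVec, map_sub, map_smul, inner_sub_right, inner_smul_right, hνJ,
      mul_one]
  simp only [norm_unusedVec_sq]
  rw [integral_const_mul, integral_add (hA.integrable _) (hA.integrable _),
    integral_sub (hA.integrable _) (hA.integrable _),
    integral_sub (hA.integrable _) (hA.integrable _), harrivals]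
  simp only [integral_const, probReal_univ, one_smul]
  ring

lemma abs_norm_starProjection_nextQueue_sq_sub_le {κ : ℝ} (hκ : 0 < κ) (q a : SwitchState n)
    (τ : Equiv.Perm (Fin n)) :
    |‖(marginSpace (Fin n) (Fin n)).starProjection (queueVec (nextQueue q a τ))‖ ^ 2 -
        ‖(marginSpace (Fin n) (Fin n)).starProjection
          (queueVec q + queueVec a - serviceVec τ)‖ ^ 2| ≤
      κ * Metric.infDist (queueVec (nextQueue q a τ)) (collapseCone (Fin n) (Fin n)) ^ 2 +
        (1 / κ + 1) * ‖unusedVec q a τ‖ ^ 2 := by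
  have hsub : queueVec q + queueVec a - serviceVec τ =
      queueVec (nextQueue q a τ) - unusedVec q a τ := by
    rw [queueVec_nextQueue, add_sub_cancel_right]
  have hdist := norm_sub_starProjection_le_infDist (marginSpace (Fin n) (Fin n))
    collapseCone_subset_marginSpace ⟨0, zero_mem _⟩ (queueVec (nextQueue q a τ))
  rw [hsub]
  refine (abs_norm_starProjection_sq_sub_le _
    (inner_queueVec_nextQueue_unusedVec q a τ)).trans ?_
  set d := ‖queueVec (nextQueue q a τ) - (marginSpace (Fin n) (Fin n)).starProjection _‖
  set D := Metric.infDist (queueVec (nextQueue q a τ)) (collapseCone (Fin n) (Fin n))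
  set u := ‖unusedVec q a τ‖
  have hyoung : 2 * D * u ≤ κ * D ^ 2 + 1 / κ * u ^ 2 := by
    have : 0 ≤ (κ * D - u) ^ 2 / κ := by positivity
    have hsq : (κ * D - u) ^ 2 / κ = κ * D ^ 2 + 1 / κ * u ^ 2 - 2 * D * u := by
      field_simp
      ring
    linarith
  have hdu : 2 * d * u ≤ 2 * D * u := by gcongr
  linarith

lemma abs_integral_norm_starProjection_nextQueue_sq_sub_le [NeZero n]
    (hA : IsArrivalLaw A amax (ν - ε • ν)) (hν : ν ∈ doublyStochastic ℝ (Fin n)) {κ : ℝ}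
    (hκ : 0 < κ) (q : SwitchState n) (τ : Equiv.Perm (Fin n)) :
    |∫ a, ‖(marginSpace (Fin n) (Fin n)).starProjection (queueVec (nextQueue q a τ))‖ ^ 2
        ∂A.toMeasure - (‖(marginSpace (Fin n) (Fin n)).starProjection (queueVec q)‖ ^ 2 -
        2 * ε * ⟪queueVec q, matVec (uniformMatrix (Fin n))⟫ + (ε ^ 2 + (2 * n - 1) / n ^ 2 *
        ∑ i, ∑ j, Var[fun a => (a i j : ℝ); A.toMeasure]))| ≤
      ∫ a, (κ * Metric.infDist (queueVec (nextQueue q a τ)) (collapseCone (Fin n) (Fin n)) ^ 2 +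
        (1 / κ + 1) * (n * ⟪queueVec (nextQueue q a τ), matVec (uniformMatrix (Fin n))⟫))
        ∂A.toMeasure -
      (1 / κ + 1) * (n * (⟪queueVec q, matVec (uniformMatrix (Fin n))⟫ - ε)) := by
  rw [← hA.integral_norm_starProjection_sq hν q τ,
    ← integral_sub (hA.integrable _) (hA.integrable _)]
  refine (abs_integral_le_integral_abs.trans (integral_mono (hA.integrable _) (hA.integrable _)
    fun a => abs_norm_starProjection_nextQueue_sq_sub_le hκ q a τ)).trans_eq ?_
  rw [integral_add (hA.integrable _) (hA.integrable _), integral_const_mul (1 / κ + 1),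
    hA.integral_norm_unusedVec_sq hν, integral_add (hA.integrable _) (hA.integrable _),
    integral_const_mul (1 / κ + 1), integral_const_mul (n : ℝ)]
  ring

end Fluctuations

section HeavyTraffic

variable {n : ℕ}

lemma integrable_infDist_queueVec_sq {μ : Measure (SwitchState n)} (hq : MemLp queueVec 2 μ) :
    Integrable (fun q => Metric.infDist (queueVec q) (collapseCone (Fin n) (Fin n)) ^ 2) μ := by
  refine (memLp_two_iff_integrable_sq .of_discrete).1
    (hq.mono .of_discrete (ae_of_all _ fun q => ?_))
  rw [Real.norm_of_nonneg Metric.infDist_nonneg]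
  simpa using Metric.infDist_le_dist_of_mem (x := queueVec q)
    (zero_mem (collapseCone (Fin n) (Fin n)))

lemma abs_integral_inner_matVec_sub_le {μ : Measure (SwitchState n)} [IsProbabilityMeasure μ]
    (hq : MemLp queueVec 2 μ) {M N : Matrix (Fin n) (Fin n) ℝ}
    (hM : M ∈ doublyStochastic ℝ (Fin n)) (hN : N ∈ doublyStochastic ℝ (Fin n)) :
    |∫ q, ⟪queueVec q, matVec M⟫ ∂μ - ∫ q, ⟪queueVec q, matVec N⟫ ∂μ| ≤
      ‖matVec M - matVec N‖ *
        (1 + ∫ q, Metric.infDist (queueVec q) (collapseCone (Fin n) (Fin n)) ^ 2 ∂μ) := by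
  have hint := hq.integrable one_le_two
  have hdist := integrable_infDist_queueVec_sq hq
  have hbound : Integrable (fun q =>
      1 + Metric.infDist (queueVec q) (collapseCone (Fin n) (Fin n)) ^ 2) μ :=
    (integrable_const 1).add hdist
  have hle (q : SwitchState n) : |⟪queueVec q, matVec M⟫ - ⟪queueVec q, matVec N⟫| ≤
      ‖matVec M - matVec N‖ *
        (1 + Metric.infDist (queueVec q) (collapseCone (Fin n) (Fin n)) ^ 2) := by
    rw [← inner_sub_right, real_inner_comm]
    refine (abs_inner_le_norm_mul_infDist_of_mem_orthogonal _ collapseCone_subset_marginSpace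
      ⟨0, zero_mem _⟩ (matVec_sub_mem_marginSpace_orthogonal hM hN) _).trans ?_
    gcongr
    nlinarith [sq_nonneg (Metric.infDist (queueVec q) (collapseCone (Fin n) (Fin n)) - 1)]
  rw [← integral_sub (hint.inner_const _) (hint.inner_const _)]
  refine (abs_integral_le_integral_abs.trans (integral_mono
    ((hint.inner_const _).sub (hint.inner_const _)).abs
    (hbound.const_mul _) hle)).trans_eq ?_
  rw [integral_const_mul, integral_add (integrable_const _) hdist]
  simp

lemma IsStationaryLaw.abs_two_mul_integral_inner_sub_le [NeZero n] {A : PMF (SwitchState n)}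
    {S : SwitchState n → PMF (Equiv.Perm (Fin n))} {Q : PMF (SwitchState n)} {amax : ℕ}
    {ν : Matrix (Fin n) (Fin n) ℝ} {ε κ : ℝ} (hQ : IsStationaryLaw A S Q)
    (hA : IsArrivalLaw A amax (ν - ε • ν)) (hν : ν ∈ doublyStochastic ℝ (Fin n))
    (hq : MemLp queueVec 2 Q.toMeasure) (hκ : 0 < κ) :
    |2 * ε * ∫ q, ⟪queueVec q, matVec (uniformMatrix (Fin n))⟫ ∂Q.toMeasure -
        (ε ^ 2 + (2 * n - 1) / n ^ 2 * ∑ i, ∑ j, Var[fun a => (a i j : ℝ); A.toMeasure])| ≤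
      κ * ∫ q, Metric.infDist (queueVec q) (collapseCone (Fin n) (Fin n)) ^ 2 ∂Q.toMeasure +
        (1 / κ + 1) * (n * ε) := by
  have hinner : Integrable (fun q => ⟪queueVec q, matVec (uniformMatrix (Fin n))⟫) Q.toMeasure :=
    (hq.integrable one_le_two).inner_const _
  have hdist := integrable_infDist_queueVec_sq hq
  have hproj : Integrable (fun q =>
      ‖(marginSpace (Fin n) (Fin n)).starProjection (queueVec q)‖ ^ 2) Q.toMeasure :=
    ((marginSpace (Fin n) (Fin n)).starProjection.comp_memLp' hq).integrable_norm_pow two_ne_zero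
  have hdrift : Integrable (fun q =>
      ‖(marginSpace (Fin n) (Fin n)).starProjection (queueVec q)‖ ^ 2 -
        2 * ε * ⟪queueVec q, matVec (uniformMatrix (Fin n))⟫) Q.toMeasure :=
    hproj.sub (hinner.const_mul _)
  have hbalance := hQ.abs_integral_sub_integral_le hA.finite_support hproj
    (hdrift.add (integrable_const _))
    ((hdist.const_mul κ).add ((hinner.const_mul n).const_mul (1 / κ + 1)))
    (((hinner.sub (integrable_const ε)).const_mul n).const_mul (1 / κ + 1))
    fun q τ _ => abs_integral_norm_starProjection_nextQueue_sq_sub_le hA hν hκ q τ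
  simp only [Pi.add_apply, Pi.sub_apply] at hbalance
  rw [integral_add hdrift (integrable_const _),
    integral_sub hproj (hinner.const_mul _),
    integral_add (hdist.const_mul κ) ((hinner.const_mul _).const_mul _)] at hbalance
  simp only [integral_const_mul, integral_sub hinner (integrable_const ε), integral_const,
    probReal_univ, one_smul] at hbalance
  convert hbalance using 1
  · congr 1
    ring
  · ring

lemma integrable_apply_of_memLp_queueVec {μ : Measure (SwitchState n)} [IsFiniteMeasure μ]
    (hq : MemLp queueVec 2 μ) (i j : Fin n) : Integrable (fun q => (q i j : ℝ)) μ :=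
  (hq.integrable one_le_two).mono .of_discrete
    (ae_of_all _ fun q => PiLp.norm_apply_le (queueVec q) (i, j))

lemma inner_queueVec_matVec (q : SwitchState n) (M : Matrix (Fin n) (Fin n) ℝ) :
    ⟪queueVec q, matVec M⟫ = ∑ i, ∑ j, M i j * (q i j : ℝ) := by
  simp only [inner_matVec_right, queueVec_apply]

lemma mul_inner_queueVec_uniformMatrix [NeZero n] (q : SwitchState n) :
    n * ⟪queueVec q, matVec (uniformMatrix (Fin n))⟫ = ∑ i, ∑ j, (q i j : ℝ) := by
  have hn : (n : ℝ) ≠ 0 := NeZero.ne _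
  rw [inner_matVec_uniformMatrix, Fintype.card_fin, mul_inv_cancel_left₀ hn]
  simp only [Fintype.sum_prod_type, queueVec_apply]

lemma inner_queueVec_permMatrix (q : SwitchState n) (π : Equiv.Perm (Fin n)) :
    ⟪queueVec q, matVec (π.permMatrix ℝ)⟫ = ∑ i, (q i (π i) : ℝ) := by
  rw [← serviceVec, inner_queueVec_serviceVec]
  simp [scheduleWeight, switchService]

variable [NeZero n] {ν σ : Matrix (Fin n) (Fin n) ℝ} {amax : ℕ} {A Q : ℝ → PMF (SwitchState n)}
  {S : ℝ → SwitchState n → PMF (Equiv.Perm (Fin n))}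

lemma tendsto_mul_integral_inner_uniformMatrix (hν : ν ∈ doublyStochastic ℝ (Fin n))
    (hν_pos : ∀ i j, 0 < ν i j)
    (hA : ∀ ε ∈ Set.Ioo (0 : ℝ) 1, IsArrivalLaw (A ε) amax (ν - ε • ν))
    (hσ : ∀ i j, Tendsto (fun ε : ℝ => Var[fun a : SwitchState n => (a i j : ℝ); (A ε).toMeasure])
      (𝓝[>] 0) (𝓝 (σ i j ^ 2)))
    (hS : ∀ ε ∈ Set.Ioo (0 : ℝ) 1, IsMaxWeight (S ε))
    (hQ : ∀ ε ∈ Set.Ioo (0 : ℝ) 1, IsStationaryLaw (A ε) (S ε) (Q ε)) :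
    Tendsto (fun ε =>
        ε * ∫ q, ⟪queueVec q, matVec (uniformMatrix (Fin n))⟫ ∂(Q ε).toMeasure)
      (𝓝[>] 0) (𝓝 ((2 * (n : ℝ) - 1) / (2 * (n : ℝ) ^ 2) * ∑ i, ∑ j, σ i j ^ 2)) := by
  obtain ⟨ε₀, hε₀, B, hB⟩ := exists_forall_integral_infDist_sq_le hν hν_pos amax
  have hid : Tendsto (fun ε : ℝ => ε) (𝓝[>] 0) (𝓝 0) := nhdsWithin_le_nhds
  have hsqrt : Tendsto Real.sqrt (𝓝[>] 0) (𝓝 0) := by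
    simpa using (Real.continuous_sqrt.tendsto 0).mono_left nhdsWithin_le_nhds
  let balance (ε : ℝ) : ℝ := ε ^ 2 + (2 * n - 1) / n ^ 2 *
    ∑ i, ∑ j, Var[fun a : SwitchState n => (a i j : ℝ); (A ε).toMeasure]
  have hbalance : Tendsto balance (𝓝[>] 0)
      (𝓝 (0 ^ 2 + (2 * n - 1) / n ^ 2 * ∑ i, ∑ j, σ i j ^ 2)) :=
    (hid.pow 2).add ((tendsto_finsetSum _ fun i _ =>
      tendsto_finsetSum _ fun j _ => hσ i j).const_mul _)
  have herror : Tendsto (fun ε =>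
      2 * ε * ∫ q, ⟪queueVec q, matVec (uniformMatrix (Fin n))⟫ ∂(Q ε).toMeasure - balance ε)
      (𝓝[>] 0) (𝓝 0) := by
    have hbound : Tendsto (fun ε => √ε * B + (√ε * n + ε * n)) (𝓝[>] 0) (𝓝 0) := by
      simpa using (hsqrt.mul_const B).add ((hsqrt.mul_const (n : ℝ)).add (hid.mul_const (n : ℝ)))
    refine squeeze_zero_norm' ?_ hbound
    filter_upwards [Ioo_mem_nhdsGT one_pos, Ioo_mem_nhdsGT hε₀] with ε hε hεε₀
    have hdist := hB ε hεε₀ _ _ _ (hA ε hε) (hS ε hε) (hQ ε hε)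
    have hmemLp := (hQ ε hε).memLp_queueVec (hS ε hε) hν hν_pos hε (hA ε hε)
    -- The choice `κ = √ε` sends both error terms `κ * B` and `n * ε / κ` to zero.
    refine ((hQ ε hε).abs_two_mul_integral_inner_sub_le (hA ε hε) hν hmemLp
      (Real.sqrt_pos.2 hε.1)).trans ?_
    have hdiv : (1 / √ε + 1) * (n * ε) = √ε * n + ε * n := by
      linear_combination n * Real.div_sqrt (x := ε)
    rw [hdiv]
    gcongr
  convert (herror.add hbalance).div_const 2 using 2 <;> ring

lemma tendsto_mul_integral_inner_matVec (hν : ν ∈ doublyStochastic ℝ (Fin n))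
    (hν_pos : ∀ i j, 0 < ν i j)
    (hA : ∀ ε ∈ Set.Ioo (0 : ℝ) 1, IsArrivalLaw (A ε) amax (ν - ε • ν))
    (hσ : ∀ i j, Tendsto (fun ε : ℝ => Var[fun a : SwitchState n => (a i j : ℝ); (A ε).toMeasure])
      (𝓝[>] 0) (𝓝 (σ i j ^ 2)))
    (hS : ∀ ε ∈ Set.Ioo (0 : ℝ) 1, IsMaxWeight (S ε))
    (hQ : ∀ ε ∈ Set.Ioo (0 : ℝ) 1, IsStationaryLaw (A ε) (S ε) (Q ε))
    {M : Matrix (Fin n) (Fin n) ℝ} (hM : M ∈ doublyStochastic ℝ (Fin n)) :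
    Tendsto (fun ε => ε * ∫ q, ⟪queueVec q, matVec M⟫ ∂(Q ε).toMeasure)
      (𝓝[>] 0) (𝓝 ((2 * (n : ℝ) - 1) / (2 * (n : ℝ) ^ 2) * ∑ i, ∑ j, σ i j ^ 2)) := by
  obtain ⟨ε₀, hε₀, B, hB⟩ := exists_forall_integral_infDist_sq_le hν hν_pos amax
  have herror : Tendsto (fun ε => ε * (∫ q, ⟪queueVec q, matVec M⟫ ∂(Q ε).toMeasure -
      ∫ q, ⟪queueVec q, matVec (uniformMatrix (Fin n))⟫ ∂(Q ε).toMeasure)) (𝓝[>] 0) (𝓝 0) := by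
    have hid : Tendsto (fun ε : ℝ => ε) (𝓝[>] 0) (𝓝 0) := nhdsWithin_le_nhds
    have hbound : Tendsto (fun ε : ℝ => ε * (‖matVec M - matVec (uniformMatrix (Fin n))‖ * (1 + B)))
        (𝓝[>] 0) (𝓝 0) := by
      simpa using hid.mul_const (‖matVec M - matVec (uniformMatrix (Fin n))‖ * (1 + B))
    refine squeeze_zero_norm' ?_ hbound
    filter_upwards [Ioo_mem_nhdsGT one_pos, Ioo_mem_nhdsGT hε₀] with ε hε hεε₀
    have hdist := hB ε hεε₀ _ _ _ (hA ε hε) (hS ε hε) (hQ ε hε)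
    have hmemLp := (hQ ε hε).memLp_queueVec (hS ε hε) hν hν_pos hε (hA ε hε)
    rw [norm_mul, Real.norm_of_nonneg hε.1.le, Real.norm_eq_abs]
    refine mul_le_mul_of_nonneg_left ?_ hε.1.le
    refine (abs_integral_inner_matVec_sub_le hmemLp hM uniformMatrix_mem_doublyStochastic).trans ?_
    gcongr
  have hsum := herror.add (tendsto_mul_integral_inner_uniformMatrix hν hν_pos hA hσ hS hQ)
  simpa only [← mul_add, sub_add_cancel, zero_add] using hsum

end HeavyTraffic

theorem mainTheorem9 (n : ℕ) (hn : 0 < n)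
    (ν σ : Matrix (Fin n) (Fin n) ℝ)
    (hν : ν ∈ doublyStochastic ℝ (Fin n)) (hν_pos : ∀ i j, 0 < ν i j)
    (amax : ℕ) (A : ℝ → PMF (SwitchState n))
    (hA : ∀ ε ∈ Set.Ioo (0 : ℝ) 1, IsArrivalLaw (A ε) amax (ν - ε • ν))
    (hσ : ∀ i j, Tendsto (fun ε : ℝ => Var[fun a : SwitchState n => (a i j : ℝ); (A ε).toMeasure])
      (𝓝[>] 0) (𝓝 (σ i j ^ 2)))
    (S : ℝ → SwitchState n → PMF (Equiv.Perm (Fin n)))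
    (hS : ∀ ε ∈ Set.Ioo (0 : ℝ) 1, IsMaxWeight (S ε)) :
    (∀ ε ∈ Set.Ioo (0 : ℝ) 1, ∃! Q : PMF (SwitchState n), IsStationaryLaw (A ε) (S ε) Q) ∧
    ∀ Q : ℝ → PMF (SwitchState n),
      (∀ ε ∈ Set.Ioo (0 : ℝ) 1, IsStationaryLaw (A ε) (S ε) (Q ε)) →
      (∀ ε ∈ Set.Ioo (0 : ℝ) 1, ∀ q₀ q : SwitchState n,
        Tendsto (fun t => queueLaw (A ε) (S ε) q₀ t q) atTop (𝓝 (Q ε q))) ∧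
      (∀ ε ∈ Set.Ioo (0 : ℝ) 1, ∀ i j,
        Integrable (fun q : SwitchState n => (q i j : ℝ)) (Q ε).toMeasure) ∧
      Tendsto (fun ε : ℝ => ε * ∫ q, (∑ i, ∑ j, (q i j : ℝ)) ∂(Q ε).toMeasure)
        (𝓝[>] 0) (𝓝 ((1 - 1 / (2 * (n : ℝ))) * ∑ i, ∑ j, σ i j ^ 2)) ∧
      Tendsto (fun ε : ℝ => ε * ∫ q, (∑ i, ∑ j, ν i j * (q i j : ℝ)) ∂(Q ε).toMeasure)
        (𝓝[>] 0) (𝓝 ((2 * (n : ℝ) - 1) / (2 * (n : ℝ) ^ 2) * ∑ i, ∑ j, σ i j ^ 2)) ∧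
      ∀ π : Equiv.Perm (Fin n),
        Tendsto (fun ε : ℝ => ε * ∫ q, (∑ i, (q i (π i) : ℝ)) ∂(Q ε).toMeasure)
          (𝓝[>] 0) (𝓝 ((2 * (n : ℝ) - 1) / (2 * (n : ℝ) ^ 2) * ∑ i, ∑ j, σ i j ^ 2)) := by
  have : NeZero n := .of_pos hn
  have hn0 : (n : ℝ) ≠ 0 := NeZero.ne _
  refine ⟨fun ε hε => existsUnique_isStationaryLaw (hS ε hε) hν hν_pos hε (hA ε hε),
    fun Q hQ => ?_⟩
  have hlimit {M : Matrix (Fin n) (Fin n) ℝ} (hM : M ∈ doublyStochastic ℝ (Fin n)) :=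
    tendsto_mul_integral_inner_matVec hν hν_pos hA hσ hS hQ hM
  refine ⟨fun ε hε => (hQ ε hε).tendsto_queueLaw (hS ε hε) hν hν_pos hε (hA ε hε),
    fun ε hε => integrable_apply_of_memLp_queueVec <|
      (hQ ε hε).memLp_queueVec (hS ε hε) hν hν_pos hε (hA ε hε), ?_, ?_, fun π => ?_⟩
  · simp only [← mul_inner_queueVec_uniformMatrix, integral_const_mul, mul_left_comm _ (n : ℝ)]
    convert (hlimit uniformMatrix_mem_doublyStochastic).const_mul (n : ℝ) using 2
    field_simp
  · simpa only [inner_queueVec_matVec] using hlimit hν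
  · simpa only [inner_queueVec_permMatrix] using hlimit (M := π.permMatrix ℝ)
      permMatrix_mem_doublyStochastic
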